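/- **Conventions.** Let $k$ be a field of characteristic zero and let $\mathcal H=\bigoplus_{d\in\mathbb Z}\mathcal H^d$, $\mathcal H'=\bigoplus_{d\in\mathbb Z}\mathcal H'^d$ be $\mathbb Z$-graded $k$-vector spaces. Let $C(\mathcal H)=\bigoplus_{n\ge 0}\mathcal H^{\otimes n}$ be the tensor coalgebra with the coproduct $\triangle(o_1\cdots o_n)=\sum_{j=0}^n (o_1\cdots o_j)\otimes(o_{j+1}\cdots o_n)$. Tensor products of maps follow the Koszul sign rule: $(f\otimes g)(x\otimes y)=(-1)^{\deg g\,\deg x}f(x)\otimes g(y)$. An $A_\infty$-algebra $(\mathcal H,\mathfrak m)$ is a degree $+1$ linear map $\mathfrak m:C(\mathcal H)\to C(\mathcal H)$ with $\triangle\mathfrak m=(\mathfrak m\otimes\mathbf 1+\mathbf 1\otimes\mathfrak m)\triangle$, $\mathfrak m^2=0$ and $m_0=0$; here $m_n$ is the component $\mathcal H^{\otimes n}\to\mathcal H$ of $\mathfrak m$. An $A_\infty$-morphism $\mathcal F:(\mathcal H,\mathfrak m)\to(\mathcal H',\mathfrak m')$ is a degree $0$ counital coalgebra homomorphism $\mathcal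 F:C(\mathcal H)\to C(\mathcal H')$ with $\mathcal F\mathfrak m=\mathfrak m'\mathcal F$ and $f_0=0$; it is an $A_\infty$-quasi-isomorphism if its component $f_1:\mathcal H\to\mathcal H'$ induces an isomorphism $H_{m_1}(\mathcal H)\to H_{m_1'}(\mathcal H')$. For $A_\infty$-morphisms $\mathcal F,\mathcal G:(\mathcal H,\mathfrak m)\to(\mathcal H',\mathfrak m')$: * $\mathcal G$ is *homotopic* to $\mathcal F$ if there is a linear map $H:C(\mathcal H)\to C(\mathcal H')$ of degree $-1$ with $\mathcal G-\mathcal F=\mathfrak m'H+H\mathfrak m$; * $\mathcal G$ is *strictly homotopic* to $\mathcal F$ if such an $H$ can be chosen with, in addition, $\triangle H=(\mathcal F\otimes H+H\otimes\mathcal G)\triangle$ and $H(1)=0$. An $A_\infty$-morphism $\mathcal F:(\mathcal H,\mathfrak m)\to(\mathcal H',\mathfrak m')$ is a *strict homotopy equivalence* if there is an $A_\infty$-morphism $\mathcal G:(\mathcal H',\mathfrak m')\to(\mathcal H,\mathfrak m)$ such that $\mathcal G\circ\mathcal F$ and $\mathcal F\circ\mathcal G$ are strictly homotopic to the respective identities.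 **Theorem.** Let $(\mathcal H,\mathfrak m)$ and $(\mathcal H',\mathfrak m')$ be $A_\infty$-algebras. 1. For every $A_\infty$-quasi-isomorphism $\mathcal F:(\mathcal H,\mathfrak m)\to(\mathcal H',\mathfrak m')$ there is an inverse $A_\infty$-quasi-isomorphism $\mathcal F^{-1}:(\mathcal H',\mathfrak m')\to(\mathcal H,\mathfrak m)$ such that $\mathcal F^{-1}\circ\mathcal F$ is homotopic to the identity of $(\mathcal H,\mathfrak m)$ and $\mathcal F\circ\mathcal F^{-1}$ is homotopic to the identity of $(\mathcal H',\mathfrak m')$. 2. An $A_\infty$-morphism $(\mathcal H,\mathfrak m)\to(\mathcal H',\mathfrak m')$ is an $A_\infty$-quasi-isomorphism if and only if it is a strict homotopy equivalence. 3. Hence there is a strict homotopy equivalence $(\mathcal H,\mathfrak m)\to(\mathcal H',\mathfrak m')$ if and only if there is an $A_\infty$-quasi-isomorphism $(\mathcal H,\mathfrak m)\to(\mathcal H',\mathfrak m')$. -/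

import Mathlib

open scoped TensorProduct DirectSum

noncomputable section

namespace AInf

section Coalgebra

variable (k : Type*) [Field k] (V : Type*) [AddCommGroup V] [Module k V]

/-- For `v : V`, the endomorphism `(x, y) ↦ (v x, 1 ⊗ v x + (v ⊗ 1) y)` of `T(V) × (T(V) ⊗ T(V))`;
it turns the pair `(x, Δ x)` into the pair `(v x, Δ (v x))`. -/
def comulStep : V →ₗ[k]
    Module.End k (TensorAlgebra k V × (TensorAlgebra k V ⊗[k] TensorAlgebra k V)) :=
  LinearMap.mk₂ k
    (fun v p => (TensorAlgebra.ι k v * p.1,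
      (1 : TensorAlgebra k V) ⊗ₜ[k] (TensorAlgebra.ι k v * p.1) +
        (TensorAlgebra.ι k v ⊗ₜ[k] (1 : TensorAlgebra k V)) * p.2))
    (by intro v w p; ext <;> simp [add_mul, TensorProduct.tmul_add, TensorProduct.add_tmul]; abel)
    (by intro c v p; ext <;> simp [← TensorProduct.smul_tmul'])
    (by intro v p q; ext <;> simp [mul_add, TensorProduct.tmul_add]; abel)
    (by intro c v p; ext <;> simp)

/-- The deconcatenation coproduct of the tensor coalgebra `⊕_{n ≥ 0} V^{⊗ n}`, whose underlying
space is `TensorAlgebra k V`: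
`Δ (o₁ ⋯ oₙ) = ∑_{j = 0}^{n} (o₁ ⋯ o_j) ⊗ (o_{j+1} ⋯ oₙ)`, see `comul_prod`. -/
def comul : TensorAlgebra k V →ₗ[k] TensorAlgebra k V ⊗[k] TensorAlgebra k V :=
  LinearMap.snd k _ _ ∘ₗ
    (LinearMap.applyₗ ((1 : TensorAlgebra k V),
      (1 : TensorAlgebra k V) ⊗ₜ[k] (1 : TensorAlgebra k V))) ∘ₗ
    (TensorAlgebra.lift k (comulStep k V)).toLinearMap

/-- The counit of the tensor coalgebra, i.e. the projection onto `V^{⊗ 0} = k`. -/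
def counit : TensorAlgebra k V →ₗ[k] k := (TensorAlgebra.algebraMapInv (M := V)).toLinearMap

/-- The projection of the tensor coalgebra onto `V^{⊗ 1} = V`. -/
def proj : TensorAlgebra k V →ₗ[k] V := TensorAlgebra.ιInv

variable {k V}

lemma lift_comulStep (x y : TensorAlgebra k V) :
    (TensorAlgebra.lift k (comulStep k V) x (y, comul k V y)).1 = x * y ∧
    (TensorAlgebra.lift k (comulStep k V) x (y, comul k V y)).2 = comul k V (x * y) := by
  have key : ∀ x : TensorAlgebra k V,
      (TensorAlgebra.lift k (comulStep k V) x (1, 1 ⊗ₜ 1)).1 = x := by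
    intro x
    have gen : ∀ (x : TensorAlgebra k V) p,
        (TensorAlgebra.lift k (comulStep k V) x p).1 = x * p.1 := by
      intro x
      induction x using TensorAlgebra.induction with
      | algebraMap r => intro p; simp [Algebra.algebraMap_eq_smul_one]
      | ι v => intro p; simp [comulStep]
      | mul a b ha hb => intro p; simp [ha, hb, mul_assoc]
      | add a b ha hb => intro p; simp [ha, hb, add_mul]
    simp [gen]
  have hy : (y, comul k V y) = TensorAlgebra.lift k (comulStep k V) y (1, 1 ⊗ₜ 1) := by
    ext
    · exact (key y).symm
    · rfl
  rw [hy, ← Module.End.mul_apply, ← map_mul]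
  exact ⟨key _, rfl⟩

lemma comul_one : comul k V 1 = 1 ⊗ₜ 1 := by
  simp [comul]

lemma comul_ι_mul (v : V) (x : TensorAlgebra k V) :
    comul k V (TensorAlgebra.ι k v * x) = 1 ⊗ₜ (TensorAlgebra.ι k v * x) +
      (TensorAlgebra.ι k v ⊗ₜ 1) * comul k V x := by
  rw [← (lift_comulStep (TensorAlgebra.ι k v) x).2]
  simp [comulStep]

lemma comul_ι (v : V) : comul k V (TensorAlgebra.ι k v) =
    1 ⊗ₜ TensorAlgebra.ι k v + TensorAlgebra.ι k v ⊗ₜ 1 := by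
  have h := comul_ι_mul (k := k) v 1
  simpa [comul_one] using h

lemma comul_prod (l : List V) :
    comul k V ((l.map (TensorAlgebra.ι k)).prod) = ∑ j ∈ Finset.range (l.length + 1),
      (((l.take j).map (TensorAlgebra.ι k)).prod ⊗ₜ[k]
        ((l.drop j).map (TensorAlgebra.ι k)).prod) := by
  induction l with
  | nil => simp [comul_one]
  | cons v l ih =>
    rw [List.map_cons, List.prod_cons, comul_ι_mul, ih, List.length_cons,
      Finset.sum_range_succ' _ (l.length + 1), Finset.mul_sum, add_comm]
    simp

lemma word_induction {p : TensorAlgebra k V → Prop} (one : p 1)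
    (add : ∀ x y, p x → p y → p (x + y)) (smul : ∀ (c : k) x, p x → p (c • x))
    (ι_mul : ∀ v x, p x → p (TensorAlgebra.ι k v * x)) (x : TensorAlgebra k V) : p x := by
  have gen : ∀ x y, p y → p (x * y) := by
    intro x
    induction x using TensorAlgebra.induction with
    | algebraMap r => intro y hy; rw [← Algebra.smul_def]; exact smul r y hy
    | ι v => exact fun y hy => ι_mul v y hy
    | mul a b ha hb => intro y hy; rw [mul_assoc]; exact ha _ (hb y hy)
    | add a b ha hb => intro y hy; rw [add_mul]; exact add _ _ (ha y hy) (hb y hy)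
  simpa using gen x 1 one

lemma proj_one : proj k V 1 = 0 := by
  let _ : Module kᵐᵒᵖ V := Module.compHom _ ((RingHom.id k).fromOpposite mul_comm)
  have _ : IsCentralScalar k V := ⟨fun r m => rfl⟩
  simp only [proj, TensorAlgebra.ιInv]
  change TrivSqZeroExt.snd (TensorAlgebra.toTrivSqZeroExt 1) = 0
  rw [map_one, TrivSqZeroExt.snd_one]

lemma proj_ι (v : V) : proj k V (TensorAlgebra.ι k v) = v :=
  TensorAlgebra.ι_leftInverse v

lemma counit_one : counit k V 1 = 1 := by simp [counit]

lemma counit_ι_mul (v : V) (x : TensorAlgebra k V) :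
    counit k V (TensorAlgebra.ι k v * x) = 0 := by
  simp [counit, TensorAlgebra.algebraMapInv]

lemma proj_ι_mul (v : V) (x : TensorAlgebra k V) :
    proj k V (TensorAlgebra.ι k v * x) = counit k V x • v := by
  let _ : Module kᵐᵒᵖ V := Module.compHom _ ((RingHom.id k).fromOpposite mul_comm)
  have _ : IsCentralScalar k V := ⟨fun r m => rfl⟩
  have hfst : ∀ x : TensorAlgebra k V,
      (TensorAlgebra.toTrivSqZeroExt x).fst = counit k V x := by
    intro x
    induction x using TensorAlgebra.induction with
    | algebraMap r =>
      rw [AlgHom.commutes, TrivSqZeroExt.algebraMap_eq_inl]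
      simp [counit, TensorAlgebra.algebraMapInv]
    | ι v => simp [counit, TensorAlgebra.algebraMapInv]
    | mul a b ha hb =>
      rw [map_mul, TrivSqZeroExt.fst_mul, ha, hb]; simp [counit]
    | add a b ha hb => rw [map_add, TrivSqZeroExt.fst_add, ha, hb, map_add]
  change (TensorAlgebra.toTrivSqZeroExt (TensorAlgebra.ι k v * x)).snd = _
  rw [map_mul, TrivSqZeroExt.snd_mul, hfst x, TensorAlgebra.toTrivSqZeroExt_ι]
  simp

/-- The map `x ⊗ y ↦ x · π(y)`, where `π` is the projection onto `V`. -/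
def mulProj : TensorAlgebra k V ⊗[k] TensorAlgebra k V →ₗ[k] TensorAlgebra k V :=
  LinearMap.mul' k (TensorAlgebra k V) ∘ₗ
    TensorProduct.map LinearMap.id (TensorAlgebra.ι k ∘ₗ proj k V)

lemma mulProj_tmul (x y : TensorAlgebra k V) :
    mulProj (x ⊗ₜ[k] y) = x * TensorAlgebra.ι k (proj k V y) := by
  simp [mulProj]

lemma mulProj_comul (x : TensorAlgebra k V) :
    mulProj (comul k V x) = x - counit k V x • 1 := by
  have hm : ∀ (v : V) (t : TensorAlgebra k V ⊗[k] TensorAlgebra k V),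
      mulProj ((TensorAlgebra.ι k v ⊗ₜ 1) * t) = TensorAlgebra.ι k v * mulProj t := by
    intro v t
    induction t using TensorProduct.induction_on with
    | zero => simp
    | tmul a b => simp [mulProj_tmul, mul_assoc]
    | add a b ha hb => rw [mul_add, map_add, ha, hb, map_add, mul_add]
  induction x using word_induction with
  | one => simp [comul_one, mulProj_tmul, proj_one, counit_one]
  | add x y hx hy => rw [map_add, map_add, hx, hy, map_add, add_smul]; abel
  | smul c x hx => rw [map_smul, map_smul, hx, map_smul, smul_sub, smul_assoc]
  | ι_mul v x hx =>
    rw [comul_ι_mul, map_add, hm, hx, mulProj_tmul, proj_ι_mul, counit_ι_mul]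
    simp [mul_sub]

lemma counit_tmul_counit_comul (x : TensorAlgebra k V) :
    (LinearMap.mul' k k ∘ₗ TensorProduct.map (counit k V) (counit k V)) (comul k V x) =
      counit k V x := by
  have hm : ∀ (v : V) (t : TensorAlgebra k V ⊗[k] TensorAlgebra k V),
      (LinearMap.mul' k k ∘ₗ TensorProduct.map (counit k V) (counit k V))
        ((TensorAlgebra.ι k v ⊗ₜ 1) * t) = 0 := by
    intro v t
    induction t using TensorProduct.induction_on with
    | zero => simp
    | tmul a b => simp [counit_ι_mul]
    | add a b ha hb => rw [mul_add, map_add, ha, hb, add_zero]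
  induction x using word_induction with
  | one => simp [comul_one, counit_one]
  | add x y hx hy => rw [map_add, map_add, hx, hy, map_add]
  | smul c x hx => rw [map_smul, map_smul, hx, map_smul]
  | ι_mul v x hx => rw [comul_ι_mul, map_add, hm]; simp [counit_ι_mul]

lemma counit_of_primitive {x : TensorAlgebra k V} (h : comul k V x = 1 ⊗ₜ x + x ⊗ₜ 1) :
    counit k V x = 0 := by
  have := counit_tmul_counit_comul x
  rw [h] at this
  simpa [counit_one] using this

/-- An element `x` with `Δ x = 1 ⊗ x + x ⊗ 1` lies in `V`. -/
lemma eq_ι_of_primitive {x : TensorAlgebra k V} (h : comul k V x = 1 ⊗ₜ x + x ⊗ₜ 1) :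
    x = TensorAlgebra.ι k (proj k V x) := by
  have := mulProj_comul x
  rw [h, counit_of_primitive h, map_add, mulProj_tmul, mulProj_tmul, proj_one] at this
  simpa using this.symm

end Coalgebra

section Grading

variable {k : Type*} [Field k] {V : Type*} [AddCommGroup V] [Module k V]

/-- The degree `d` part of the tensor coalgebra of a graded vector space `V = ⊕ 𝒱 e`: the span of
the words `o₁ ⋯ oₙ` (`n ≥ 0`) in homogeneous elements with `deg o₁ + ⋯ + deg oₙ = d`. -/
def tensorDeg (𝒱 : ℤ → Submodule k V) (d : ℤ) : Submodule k (TensorAlgebra k V) :=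
  Submodule.span k {x | ∃ l : List (Σ e : ℤ, 𝒱 e), (l.map Sigma.fst).sum = d ∧
    x = (l.map fun o => TensorAlgebra.ι k (o.2 : V)).prod}

/-- A linear map between tensor coalgebras is homogeneous of degree `r`. -/
def HasDegree {W : Type*} [AddCommGroup W] [Module k W] (𝒱 : ℤ → Submodule k V)
    (𝒲 : ℤ → Submodule k W) (r : ℤ) (f : TensorAlgebra k V →ₗ[k] TensorAlgebra k W) : Prop :=
  ∀ d, ∀ x ∈ tensorDeg 𝒱 d, f x ∈ tensorDeg 𝒲 (d + r)

/-- The linear involution `v ↦ (-1)^{deg v} v` of a graded vector space. -/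
def signMap (𝒱 : ℤ → Submodule k V) [DirectSum.Decomposition 𝒱] : V →ₗ[k] V :=
  DirectSum.toModule k ℤ V (fun d => ((-1 : k) ^ d) • (𝒱 d).subtype) ∘ₗ
    (DirectSum.decomposeLinearEquiv 𝒱).toLinearMap

/-- The linear involution `x ↦ (-1)^{deg x} x` of the tensor coalgebra. -/
def koszul (𝒱 : ℤ → Submodule k V) [DirectSum.Decomposition 𝒱] :
    TensorAlgebra k V →ₗ[k] TensorAlgebra k V :=
  (TensorAlgebra.lift k (TensorAlgebra.ι k ∘ₗ signMap 𝒱)).toLinearMap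

variable (𝒱 : ℤ → Submodule k V) [DirectSum.Decomposition 𝒱]

lemma koszul_one : koszul 𝒱 1 = 1 := by simp [koszul]

lemma koszul_of_mem {d : ℤ} {x : TensorAlgebra k V} (hx : x ∈ tensorDeg 𝒱 d) :
    koszul 𝒱 x = ((-1 : k) ^ d) • x := by
  induction hx using Submodule.span_induction with
  | zero => simp
  | add x y _ _ hx hy => rw [map_add, hx, hy, smul_add]
  | smul c x _ hx => rw [map_smul, hx, smul_comm]
  | mem x hx =>
    obtain ⟨l, rfl, rfl⟩ := hx
    induction l with
    | nil => simp [koszul]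
    | cons o l ih =>
      have ho : signMap 𝒱 (o.2 : V) = ((-1 : k) ^ o.1) • (o.2 : V) := by
        simp [signMap]
      simp only [koszul, AlgHom.toLinearMap_apply] at ih
      simp only [koszul, List.map_cons, List.prod_cons, List.sum_cons, AlgHom.toLinearMap_apply,
        map_mul, ih, TensorAlgebra.lift_ι_apply, LinearMap.comp_apply, ho, map_smul,
        smul_mul_smul_comm]
      rw [zpow_add₀ (by simp)]

/-- The tensor product `f ⊗ g` of homogeneous linear maps between tensor coalgebras, where `f` has
degree zero and `g` has odd degree, with the Koszul sign rule
`(f ⊗ g)(x ⊗ y) = (-1)^{deg x} f x ⊗ g y`. -/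
def oddTensor {W : Type*} [AddCommGroup W] [Module k W]
    (f g : TensorAlgebra k V →ₗ[k] TensorAlgebra k W) :
    TensorAlgebra k V ⊗[k] TensorAlgebra k V →ₗ[k] TensorAlgebra k W ⊗[k] TensorAlgebra k W :=
  TensorProduct.map (f ∘ₗ koszul 𝒱) g

end Grading

section Main

variable {k : Type*} [Field k]
  {V : Type*} [AddCommGroup V] [Module k V] {𝒱 : ℤ → Submodule k V} [DirectSum.Decomposition 𝒱]
  {W : Type*} [AddCommGroup W] [Module k W] {𝒲 : ℤ → Submodule k W} [DirectSum.Decomposition 𝒲]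
  {U : Type*} [AddCommGroup U] [Module k U] {𝒰 : ℤ → Submodule k U} [DirectSum.Decomposition 𝒰]

/-- An `A∞`-algebra structure on the graded vector space `V = ⊕ 𝒱 d` (in the bar convention): a
coderivation `m` of degree one on the tensor coalgebra with `m² = 0` and `m₀ = 0`. -/
structure AInfAlgebra (𝒱 : ℤ → Submodule k V) [DirectSum.Decomposition 𝒱] where
  /-- the codifferential -/
  m : TensorAlgebra k V →ₗ[k] TensorAlgebra k V
  degree_one : HasDegree 𝒱 𝒱 1 m
  coderivation : comul k V ∘ₗ m =
    (TensorProduct.map m LinearMap.id + oddTensor 𝒱 LinearMap.id m) ∘ₗ comul k V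
  sq_zero : m ∘ₗ m = 0
  m_zero : proj k V (m 1) = 0

/-- An `A∞`-morphism: a (counital) cohomomorphism of degree zero between the tensor coalgebras that
commutes with the codifferentials and satisfies `f₀ = 0`. -/
structure AInfHom (A : AInfAlgebra 𝒱) (B : AInfAlgebra 𝒲) where
  /-- the cohomomorphism -/
  F : TensorAlgebra k V →ₗ[k] TensorAlgebra k W
  degree_zero : HasDegree 𝒱 𝒲 0 F
  map_comul : comul k W ∘ₗ F = TensorProduct.map F F ∘ₗ comul k V
  map_counit : counit k W ∘ₗ F = counit k V
  f_zero : proj k W (F 1) = 0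
  comm : F ∘ₗ A.m = B.m ∘ₗ F

namespace AInfHom

variable {A : AInfAlgebra 𝒱} {B : AInfAlgebra 𝒲} {C : AInfAlgebra 𝒰}

lemma map_one (F : AInfHom A B) : F.F 1 = 1 := by
  have h := LinearMap.congr_fun F.map_comul 1
  have h1 := LinearMap.congr_fun F.map_counit 1
  simp only [LinearMap.comp_apply, comul_one, TensorProduct.map_tmul, counit_one] at h h1
  have := mulProj_comul (F.F 1)
  rw [h, h1, mulProj_tmul, F.f_zero] at this
  rw [map_zero, mul_zero, one_smul] at this
  exact (sub_eq_zero.mp this.symm)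

/-- The identity `A∞`-morphism. -/
def id (A : AInfAlgebra 𝒱) : AInfHom A A where
  F := LinearMap.id
  degree_zero := by intro d x hx; simpa using hx
  map_comul := by simp
  map_counit := by simp
  f_zero := by simp [proj_one]
  comm := by simp

/-- The composition `G ∘ F` of `A∞`-morphisms. -/
def comp (G : AInfHom B C) (F : AInfHom A B) : AInfHom A C where
  F := G.F ∘ₗ F.F
  degree_zero := by
    intro d x hx
    have := G.degree_zero _ _ (F.degree_zero d x hx)
    simpa using this
  map_comul := by
    rw [← LinearMap.comp_assoc, G.map_comul, LinearMap.comp_assoc, F.map_comul,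
      ← LinearMap.comp_assoc, ← TensorProduct.map_comp]
  map_counit := by rw [← LinearMap.comp_assoc, G.map_counit, F.map_counit]
  f_zero := by simp [F.map_one, G.map_one, proj_one]
  comm := by rw [LinearMap.comp_assoc, F.comm, ← LinearMap.comp_assoc, G.comm, LinearMap.comp_assoc]

end AInfHom

namespace AInfAlgebra

variable (A : AInfAlgebra 𝒱)

/-- The differential `m1 : V → V`. -/
def m1 : V →ₗ[k] V := proj k V ∘ₗ A.m ∘ₗ TensorAlgebra.ι k

/-- The cohomology `ker m1 / im m1`. -/
abbrev Cohomology : Type _ :=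
  LinearMap.ker A.m1 ⧸ (LinearMap.range A.m1).submoduleOf (LinearMap.ker A.m1)

lemma m_one : A.m 1 = 0 := by
  have h := LinearMap.congr_fun A.coderivation 1
  simp only [LinearMap.comp_apply, comul_one, LinearMap.add_apply, TensorProduct.map_tmul,
    oddTensor, koszul_one, LinearMap.id_apply] at h
  rw [add_comm] at h
  rw [eq_ι_of_primitive h, A.m_zero, map_zero]

lemma m_ι (v : V) : A.m (TensorAlgebra.ι k v) = TensorAlgebra.ι k (A.m1 v) := by
  have h := LinearMap.congr_fun A.coderivation (TensorAlgebra.ι k v)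
  simp only [LinearMap.comp_apply, comul_ι, LinearMap.add_apply, map_add, TensorProduct.map_tmul,
    oddTensor, koszul_one, LinearMap.id_apply, A.m_one, TensorProduct.zero_tmul,
    TensorProduct.tmul_zero, add_zero, zero_add] at h
  exact eq_ι_of_primitive h

lemma m1_m1 (v : V) : A.m1 (A.m1 v) = 0 := by
  have h := LinearMap.congr_fun A.sq_zero (TensorAlgebra.ι k v)
  simpa [m_ι] using h

end AInfAlgebra

namespace AInfHom

variable {A : AInfAlgebra 𝒱} {B : AInfAlgebra 𝒲} (F : AInfHom A B)

/-- The linear part `f₁ : V → W` of an `A∞`-morphism. -/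
def f1 : V →ₗ[k] W := proj k W ∘ₗ F.F ∘ₗ TensorAlgebra.ι k

lemma F_ι (v : V) : F.F (TensorAlgebra.ι k v) = TensorAlgebra.ι k (F.f1 v) := by
  have h := LinearMap.congr_fun F.map_comul (TensorAlgebra.ι k v)
  simp only [LinearMap.comp_apply, comul_ι, map_add, TensorProduct.map_tmul, F.map_one] at h
  exact eq_ι_of_primitive h

lemma f1_m1 (v : V) : F.f1 (A.m1 v) = B.m1 (F.f1 v) := by
  have h := LinearMap.congr_fun F.comm (TensorAlgebra.ι k v)
  simp only [LinearMap.comp_apply, A.m_ι, F_ι, B.m_ι] at h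
  exact TensorAlgebra.ι_leftInverse.injective h

/-- The map `ker m₁ → ker m₁'` induced by `f₁`. -/
def kerMap : LinearMap.ker A.m1 →ₗ[k] LinearMap.ker B.m1 :=
  F.f1.restrict fun v hv => by
    rw [LinearMap.mem_ker] at hv ⊢
    rw [← f1_m1, hv, map_zero]

/-- The map induced by `f₁` on the cohomology of `m₁`. -/
def cohomologyMap : A.Cohomology →ₗ[k] B.Cohomology :=
  Submodule.mapQ _ _ F.kerMap (by
    rintro ⟨_, hx⟩ ⟨w, rfl⟩
    exact ⟨F.f1 w, (F.f1_m1 w).symm⟩)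

/-- `A∞`-quasi-isomorphisms. -/
def IsQuasiIso : Prop := Function.Bijective F.cohomologyMap

/-- `H` is a homotopy operator between the `A∞`-morphisms `G` and `F`:
a linear map of degree minus one between the tensor coalgebras with `G - F = m' H + H m`. -/
structure IsHomotopyOperator (G F : AInfHom A B)
    (H : TensorAlgebra k V →ₗ[k] TensorAlgebra k W) : Prop where
  degree : HasDegree 𝒱 𝒲 (-1) H
  eq : G.F - F.F = B.m ∘ₗ H + H ∘ₗ A.m

/-- `G` is homotopic to `F`. -/
def Homotopic (G F : AInfHom A B) : Prop :=
  ∃ H : TensorAlgebra k V →ₗ[k] TensorAlgebra k W, IsHomotopyOperator G F H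

/-- `G` is homotopic to `F` through a homotopy operator `H` that satisfies
`Δ H = (F ⊗ H + H ⊗ G) Δ` and `H 1 = 0`, i.e. through an operator `H = ∑_{n ≥ 1} F ⊗ hₙ ⊗ G` with
`hₙ : V^{⊗ n} → W` of degree minus one. -/
def StrictlyHomotopic (G F : AInfHom A B) : Prop :=
  ∃ H : TensorAlgebra k V →ₗ[k] TensorAlgebra k W, IsHomotopyOperator G F H ∧
    comul k W ∘ₗ H = (oddTensor 𝒱 F.F H + TensorProduct.map H G.F) ∘ₗ comul k V ∧
    H 1 = 0

/-- `F` is a homotopy equivalence in the sense of `StrictlyHomotopic`. -/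
def IsStrictHomotopyEquiv (F : AInfHom A B) : Prop :=
  ∃ G : AInfHom B A, StrictlyHomotopic (G.comp F) (AInfHom.id A) ∧
    StrictlyHomotopic (F.comp G) (AInfHom.id B)

end AInfHom

end Main

end AInf

end

/-! The tensor coalgebra is cofree in the conilpotent sense: a cohomomorphism, or a coderivation
over two cohomomorphisms, is determined by its composition with the projection onto letters
(`IsCohom.ext`, `IsCoder.ext`), and such maps are built from prescribed components (`cohomOf`,
`coderOf`). Identities between them are therefore checked on components, and new maps are found by
recursion on word length. Such a recursion is solved as a fixed point of a map that gains one letter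
at each application.

The core case is a morphism `F` whose linear part is surjective with acyclic kernel. Linear algebra
over a field gives a graded strong deformation retraction `(g, s)` with `f₁ g = 1` and `f₁ s = 0`
(`Retraction.nonempty`). It drives two recursions: one for a morphism `G` with `F G = 1` on the
nose, and one for a strict homotopy operator `H` from the identity to `G F` with `F H = 0`. In both,
the defect of the desired equation satisfies a homogeneous recursion of the same type and so
vanishes (`Retraction.inv_comm`, `Retraction.strictlyHomotopic`).

A general quasi-isomorphism `F : A → B` is reduced to this case by adding a contractible complex `Q`
to `A`. The inclusion `i` and the projection `p` between `A` and `A ⊕ Q` are inverse up to strict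
homotopy. A homotopy can be prescribed by its starting point and its component (`exists_transport`);
starting at `F p`, its end point is a morphism `F'` on `A ⊕ Q` with `F' i = F`, and for a suitable
`Q` the linear part of `F'` is surjective with acyclic kernel. If `F' G' = 1` and `G' F'` is
strictly homotopic to `1`, then `G = p G'` is the inverse: `G F = p G' F' i` is strictly homotopic
to `p i = 1`, and `F G = F' i p G'` to `F' G' = 1`.

Conversely, a strict homotopy has a linear part, which is a chain homotopy, so a strict homotopy
equivalence induces an isomorphism on cohomology. -/

noncomputable section

namespace AInf

/-! ### Words, agreement up to a length, and fixed points of recursions on word length -/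

section Words

variable {k : Type*} [Field k] {V : Type*} [AddCommGroup V] [Module k V]
  {X : Type*} [AddCommGroup X] [Module k X]

variable (k) in
/-- The word `o₁ ⋯ oₙ` in the tensor coalgebra. -/
def word (l : List V) : TensorAlgebra k V := (l.map (TensorAlgebra.ι k)).prod

lemma word_nil : word k ([] : List V) = 1 := rfl

lemma word_cons (v : V) (l : List V) :
    word k (v :: l) = TensorAlgebra.ι k v * word k l := by simp [word]

lemma word_append (l l' : List V) : word k (l ++ l') = word k l * word k l' := by
  simp [word]

lemma comul_word (l : List V) :
    comul k V (word k l) = ∑ j ∈ Finset.range (l.length + 1),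
      word k (l.take j) ⊗ₜ[k] word k (l.drop j) := comul_prod l

lemma counit_word_cons (v : V) (l : List V) : counit k V (word k (v :: l)) = 0 := by
  rw [word_cons, counit_ι_mul]

lemma ext_word {f g : TensorAlgebra k V →ₗ[k] X} (h : ∀ l : List V, f (word k l) = g (word k l)) :
    f = g := by
  -- The arbitrary word in front lets the induction on `x` move its letters into the word one at a
  -- time.
  have key : ∀ x : TensorAlgebra k V, ∀ l : List V, f (word k l * x) = g (word k l * x) := by
    intro x
    induction x using word_induction with
    | one => intro l; simpa using h l
    | add x y hx hy => intro l; simp only [mul_add, map_add, hx, hy]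
    | smul c x hx => intro l; simp only [mul_smul_comm, map_smul, hx]
    | ι_mul v x hx =>
      intro l
      have := hx (l ++ [v])
      simpa only [word_append, word_cons, word_nil, mul_one, mul_assoc] using this
  ext x
  simpa [word_nil] using key x []

lemma word_mem (l : List V) :
    word k l ∈ (LinearMap.range (TensorAlgebra.ι k : V →ₗ[k] TensorAlgebra k V)) ^ l.length := by
  induction l with
  | nil => simp [word_nil]
  | cons v l ih =>
    rw [word_cons, List.length_cons, pow_succ']
    exact Submodule.mul_mem_mul ⟨v, rfl⟩ ih

/-- The linear map that agrees with `s n` on words of length `n`. -/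
def glue (s : ℕ → TensorAlgebra k V →ₗ[k] X) : TensorAlgebra k V →ₗ[k] X :=
  DirectSum.toModule k ℕ X (fun n => s n ∘ₗ
    ((LinearMap.range (TensorAlgebra.ι k : V →ₗ[k] TensorAlgebra k V)) ^ n).subtype) ∘ₗ
  (DirectSum.decomposeLinearEquiv
    (fun n : ℕ => (LinearMap.range (TensorAlgebra.ι k : V →ₗ[k] TensorAlgebra k V)) ^ n)).toLinearMap

lemma glue_word (s : ℕ → TensorAlgebra k V →ₗ[k] X) (l : List V) :
    glue s (word k l) = s l.length (word k l) := by
  simp only [glue, LinearMap.comp_apply, LinearEquiv.coe_coe,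
    DirectSum.decomposeLinearEquiv_apply]
  rw [DirectSum.decompose_of_mem _ (word_mem l), ← DirectSum.lof_eq_of k, DirectSum.toModule_lof]
  simp

/-- Two linear maps agree on words of length less than `n`. -/
def AgreeBelow (n : ℕ) (f g : TensorAlgebra k V →ₗ[k] X) : Prop :=
  ∀ l : List V, l.length < n → f (word k l) = g (word k l)

lemma AgreeBelow.symm {n : ℕ} {f g : TensorAlgebra k V →ₗ[k] X} (h : AgreeBelow n f g) :
    AgreeBelow n g f := fun l hl => (h l hl).symm

lemma AgreeBelow.trans {n : ℕ} {f g j : TensorAlgebra k V →ₗ[k] X} (h : AgreeBelow n f g)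
    (h' : AgreeBelow n g j) : AgreeBelow n f j := fun l hl => (h l hl).trans (h' l hl)

lemma eq_of_agreeBelow {f g : TensorAlgebra k V →ₗ[k] X} (h : ∀ n, AgreeBelow n f g) : f = g :=
  ext_word fun l => h (l.length + 1) l (Nat.lt_succ_self _)

lemma agreeBelow_zero (f g : TensorAlgebra k V →ₗ[k] X) : AgreeBelow 0 f g :=
  fun _ hl => absurd hl (Nat.not_lt_zero _)

/-- The base case is vacuous, so an identity of linear maps only requires showing that agreement
gains one letter. Most vanishing arguments below end here. -/
lemma eq_of_agreeBelow_succ {f g : TensorAlgebra k V →ₗ[k] X}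
    (h : ∀ n, AgreeBelow n f g → AgreeBelow (n + 1) f g) : f = g := by
  refine eq_of_agreeBelow fun n => ?_
  induction n with
  | zero => exact agreeBelow_zero f g
  | succ n ih => exact h n ih

lemma agreeBelow_sub_zero {n : ℕ} {f g : TensorAlgebra k V →ₗ[k] X} :
    AgreeBelow n (f - g) 0 ↔ AgreeBelow n f g := by
  refine forall₂_congr fun l _ => ?_
  simp [sub_eq_zero]

/-- `Φ` improves the agreement of linear maps by one letter. -/
def Contracting (Φ : (TensorAlgebra k V →ₗ[k] X) → (TensorAlgebra k V →ₗ[k] X)) : Prop :=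
  ∀ n f g, AgreeBelow n f g → AgreeBelow (n + 1) (Φ f) (Φ g)

/-- The limit of the iterates of `Φ`; it is the fixed point of `Φ` if `Φ` is contracting. -/
def fix (Φ : (TensorAlgebra k V →ₗ[k] X) → (TensorAlgebra k V →ₗ[k] X)) :
    TensorAlgebra k V →ₗ[k] X :=
  -- The iterate `n + 1` is needed for words of length `n`: `n` applications of a contracting map
  -- settle only the words of length less than `n`.
  glue fun n => Φ^[n + 1] 0

lemma fix_word (Φ : (TensorAlgebra k V →ₗ[k] X) → (TensorAlgebra k V →ₗ[k] X)) (l : List V) :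
    fix Φ (word k l) = (Φ^[l.length + 1] 0) (word k l) := glue_word _ l

lemma Contracting.agreeBelow_iterate
    {Φ : (TensorAlgebra k V →ₗ[k] X) → (TensorAlgebra k V →ₗ[k] X)} (h : Contracting Φ)
    (n : ℕ) (f g : TensorAlgebra k V →ₗ[k] X) : AgreeBelow n (Φ^[n] f) (Φ^[n] g) := by
  induction n with
  | zero => exact agreeBelow_zero _ _
  | succ n ih =>
    rw [Function.iterate_succ_apply', Function.iterate_succ_apply']
    exact h n _ _ ih

lemma Contracting.fix_agreeBelow
    {Φ : (TensorAlgebra k V →ₗ[k] X) → (TensorAlgebra k V →ₗ[k] X)} (h : Contracting Φ) (n : ℕ) :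
    AgreeBelow n (fix Φ) (Φ^[n] 0) := by
  intro l hl
  rw [fix_word]
  obtain ⟨m, rfl⟩ := Nat.exists_eq_add_of_le (Nat.succ_le_of_lt hl)
  -- The surplus `m` iterations are moved into the starting point, so that both sides are iterates
  -- of the same order `l.length + 1` from different starting points.
  rw [Nat.succ_eq_add_one, Function.iterate_add_apply Φ (l.length + 1) m 0]
  exact h.agreeBelow_iterate _ _ _ l (Nat.lt_succ_self _)

lemma Contracting.fix_eq
    {Φ : (TensorAlgebra k V →ₗ[k] X) → (TensorAlgebra k V →ₗ[k] X)} (h : Contracting Φ) :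
    fix Φ = Φ (fix Φ) := by
  refine eq_of_agreeBelow_succ fun n _ => ?_
  refine (h.fix_agreeBelow (n + 1)).trans ?_
  rw [Function.iterate_succ_apply']
  exact (h n _ _ (h.fix_agreeBelow n)).symm

lemma Contracting.unique
    {Φ : (TensorAlgebra k V →ₗ[k] X) → (TensorAlgebra k V →ₗ[k] X)} (h : Contracting Φ)
    {f g : TensorAlgebra k V →ₗ[k] X} (hf : f = Φ f) (hg : g = Φ g) : f = g := by
  refine eq_of_agreeBelow_succ fun n hn => ?_
  rw [hf, hg]
  exact h n _ _ hn

end Words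

/-! ### The convolution product -/

section Convolution

variable {k : Type*} [Field k] {V : Type*} [AddCommGroup V] [Module k V]
  {R : Type*} [Ring R] [Algebra k R] {S : Type*} [Ring S] [Algebra k S]

/-- The convolution product of linear maps from the tensor coalgebra to an algebra. -/
def conv (f g : TensorAlgebra k V →ₗ[k] R) : TensorAlgebra k V →ₗ[k] R :=
  LinearMap.mul' k R ∘ₗ TensorProduct.map f g ∘ₗ comul k V

lemma conv_word (f g : TensorAlgebra k V →ₗ[k] R) (l : List V) :
    conv f g (word k l) = ∑ j ∈ Finset.range (l.length + 1),
      f (word k (l.take j)) * g (word k (l.drop j)) := by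
  simp [conv, comul_word]

lemma conv_one (f g : TensorAlgebra k V →ₗ[k] R) : conv f g 1 = f 1 * g 1 := by
  simp [conv, comul_one]

lemma add_conv (f f' g : TensorAlgebra k V →ₗ[k] R) :
    conv (f + f') g = conv f g + conv f' g := by
  simp [conv, TensorProduct.map_add_left, LinearMap.add_comp, LinearMap.comp_add]

lemma conv_add (f g g' : TensorAlgebra k V →ₗ[k] R) :
    conv f (g + g') = conv f g + conv f g' := by
  simp [conv, TensorProduct.map_add_right, LinearMap.add_comp, LinearMap.comp_add]

lemma conv_zero (f : TensorAlgebra k V →ₗ[k] R) : conv f 0 = 0 := by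
  have := conv_add f 0 0
  simpa using this

lemma zero_conv (f : TensorAlgebra k V →ₗ[k] R) : conv 0 f = 0 := by
  have := add_conv 0 0 f
  simpa using this

lemma conv_neg (f g : TensorAlgebra k V →ₗ[k] R) : conv f (-g) = -conv f g := by
  have := conv_add f g (-g)
  rw [add_neg_cancel, conv_zero] at this
  exact (neg_eq_of_add_eq_zero_right this.symm).symm

lemma conv_sub (f g g' : TensorAlgebra k V →ₗ[k] R) :
    conv f (g - g') = conv f g - conv f g' := by
  rw [sub_eq_add_neg, conv_add, conv_neg, sub_eq_add_neg]

/-- A cut of a word either precedes its first letter or leaves that letter in the left factor. -/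
lemma conv_ι_mul (f g : TensorAlgebra k V →ₗ[k] R) (v : V) (x : TensorAlgebra k V) :
    conv f g (TensorAlgebra.ι k v * x) = f 1 * g (TensorAlgebra.ι k v * x) +
      conv (f ∘ₗ LinearMap.mulLeft k (TensorAlgebra.ι k v)) g x := by
  have h : ∀ t : TensorAlgebra k V ⊗[k] TensorAlgebra k V,
      LinearMap.mul' k R (TensorProduct.map f g ((TensorAlgebra.ι k v ⊗ₜ 1) * t)) =
      LinearMap.mul' k R (TensorProduct.map (f ∘ₗ LinearMap.mulLeft k (TensorAlgebra.ι k v)) g t) := by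
    intro t
    induction t using TensorProduct.induction_on with
    | zero => simp
    | tmul a b => simp
    | add a b ha hb => simp only [mul_add, map_add, ha, hb]
  simp only [conv, LinearMap.comp_apply, comul_ι_mul, map_add, h]
  simp

/-- Coassociativity of deconcatenation, proved by splitting off the first letter. That letter is
absorbed into the left factor, which is why the induction keeps `f` and `g` general. -/
lemma conv_assoc (f g h : TensorAlgebra k V →ₗ[k] R) :
    conv (conv f g) h = conv f (conv g h) := by
  ext x
  induction x using word_induction generalizing f g with
  | one => simp only [conv_one, mul_assoc]
  | add x y hx hy => simp only [map_add, hx, hy]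
  | smul c x hx => simp only [map_smul, hx]
  | ι_mul v x hx =>
    have e : conv f g ∘ₗ LinearMap.mulLeft k (TensorAlgebra.ι k v) =
        LinearMap.mulLeft k (f 1) ∘ₗ (g ∘ₗ LinearMap.mulLeft k (TensorAlgebra.ι k v)) +
        conv (f ∘ₗ LinearMap.mulLeft k (TensorAlgebra.ι k v)) g := by
      ext y
      simp [conv_ι_mul]
    have e2 : ∀ (r : R) (f g : TensorAlgebra k V →ₗ[k] R) (y : TensorAlgebra k V),
        conv (LinearMap.mulLeft k r ∘ₗ f) g y = r * conv f g y := by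
      intro r f g y
      simp only [conv, LinearMap.comp_apply]
      generalize comul k V y = t
      induction t using TensorProduct.induction_on with
      | zero => simp
      | tmul a b => simp [mul_assoc]
      | add a b ha hb => simp only [mul_add, map_add, ha, hb]
    rw [conv_ι_mul, conv_ι_mul, conv_ι_mul, e, add_conv, LinearMap.add_apply, e2, hx, conv_one]
    simp only [mul_add, mul_assoc, add_assoc]

/-- The unit of the convolution product. -/
def convUnit (V R : Type*) [AddCommGroup V] [Module k V] [Ring R] [Algebra k R] :
    TensorAlgebra k V →ₗ[k] R := Algebra.linearMap k R ∘ₗ counit k V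

lemma convUnit_one : convUnit (k := k) V R 1 = 1 := by simp [convUnit, counit_one]

lemma convUnit_cons (v : V) (l : List V) : convUnit (k := k) V R (word k (v :: l)) = 0 := by
  simp [convUnit, counit_word_cons]

lemma convUnit_conv (f : TensorAlgebra k V →ₗ[k] R) : conv (convUnit V R) f = f := by
  refine ext_word fun l => ?_
  rw [conv_word, Finset.sum_range_succ']
  simp only [List.take_zero, List.drop_zero, word_nil, convUnit_one, one_mul]
  rw [Finset.sum_eq_zero, zero_add]
  intro j hj
  rw [Finset.mem_range] at hj
  cases l with
  | nil => simp at hj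
  | cons v l => simp [convUnit_cons]

lemma conv_convUnit (f : TensorAlgebra k V →ₗ[k] R) : conv f (convUnit V R) = f := by
  refine ext_word fun l => ?_
  rw [conv_word, Finset.sum_range_succ, List.take_length, List.drop_length]
  simp only [word_nil, convUnit_one, mul_one]
  rw [Finset.sum_eq_zero, zero_add]
  intro j hj
  rw [Finset.mem_range] at hj
  obtain ⟨v, l', hl⟩ := List.exists_cons_of_ne_nil
    (show l.drop j ≠ [] by simpa using hj)
  rw [hl, convUnit_cons, mul_zero]

lemma algHom_comp_conv (a : R →ₐ[k] S) (f g : TensorAlgebra k V →ₗ[k] R) :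
    a.toLinearMap ∘ₗ conv f g = conv (a.toLinearMap ∘ₗ f) (a.toLinearMap ∘ₗ g) := by
  refine ext_word fun l => ?_
  simp [conv_word]

/-- As `f` kills the empty word, `g` is evaluated only on words that have lost a letter. This is one
of the two sources of contraction; the other is `IsCoder.higher_agreeBelow`. -/
lemma AgreeBelow.conv_left {n : ℕ} {f g g' : TensorAlgebra k V →ₗ[k] R} (hf : f 1 = 0)
    (h : AgreeBelow n g g') : AgreeBelow (n + 1) (conv f g) (conv f g') := by
  intro l hl
  rw [conv_word, conv_word]
  refine Finset.sum_congr rfl fun j _ => ?_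
  rcases j with _ | j
  · simp [word_nil, hf]
  · rcases l with _ | ⟨v, l⟩
    · simp [word_nil, hf]
    · rw [h]
      simp at hl ⊢
      omega

lemma AgreeBelow.conv_congr {n : ℕ} {f f' g g' : TensorAlgebra k V →ₗ[k] R}
    (hf : AgreeBelow n f f') (hg : AgreeBelow n g g') :
    AgreeBelow n (conv f g) (conv f' g') := by
  intro l hl
  rw [conv_word, conv_word]
  refine Finset.sum_congr rfl fun j _ => ?_
  rw [hf _ (by simp; omega), hg _ (by simp; omega)]

end Convolution

end AInf
end

noncomputable section

namespace AInf

/-! ### Cohomomorphisms and coderivations: reconstruction from components and existence -/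

section Coderivations

variable {k : Type*} [Field k] {V : Type*} [AddCommGroup V] [Module k V]
  {W : Type*} [AddCommGroup W] [Module k W] {U : Type*} [AddCommGroup U] [Module k U]

/-- The inclusion of the left tensor factor. -/
abbrev incL (k W : Type*) [Field k] [AddCommGroup W] [Module k W] :
    TensorAlgebra k W →ₐ[k] TensorAlgebra k W ⊗[k] TensorAlgebra k W :=
  Algebra.TensorProduct.includeLeft

/-- The inclusion of the right tensor factor. -/
abbrev incR (k W : Type*) [Field k] [AddCommGroup W] [Module k W] :
    TensorAlgebra k W →ₐ[k] TensorAlgebra k W ⊗[k] TensorAlgebra k W :=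
  Algebra.TensorProduct.includeRight

lemma map_comp_comul (f g : TensorAlgebra k V →ₗ[k] TensorAlgebra k W) :
    TensorProduct.map f g ∘ₗ comul k V =
      conv ((incL k W).toLinearMap ∘ₗ f) ((incR k W).toLinearMap ∘ₗ g) := by
  refine ext_word fun l => ?_
  simp [conv_word, comul_word]

/-- A cut of `ab` lies in `a` or in `b`; the cut between them is counted twice, whence the
subtracted term. -/
lemma comul_mul (a b : TensorAlgebra k W) :
    comul k W (a * b) = (a ⊗ₜ 1) * comul k W b + comul k W a * (1 ⊗ₜ b) - a ⊗ₜ b := by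
  induction a using word_induction with
  | one => simp [comul_one, ← Algebra.TensorProduct.one_def]
  | add x y hx hy =>
    simp only [add_mul, map_add, hx, hy, TensorProduct.add_tmul]; abel
  | smul c x hx =>
    simp only [smul_mul_assoc, map_smul, hx, ← TensorProduct.smul_tmul', smul_sub, smul_add]
  | ι_mul v x hx =>
    rw [mul_assoc, comul_ι_mul, hx, comul_ι_mul]
    simp only [mul_sub, mul_add, add_mul, ← mul_assoc, Algebra.TensorProduct.tmul_mul_tmul, one_mul,
      mul_one]
    abel

lemma comul_conv (f g : TensorAlgebra k V →ₗ[k] TensorAlgebra k W) :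
    comul k W ∘ₗ conv f g = conv ((incL k W).toLinearMap ∘ₗ f) (comul k W ∘ₗ g) +
      conv (comul k W ∘ₗ f) ((incR k W).toLinearMap ∘ₗ g) -
      conv ((incL k W).toLinearMap ∘ₗ f) ((incR k W).toLinearMap ∘ₗ g) := by
  refine ext_word fun l => ?_
  simp [conv_word, comul_mul, Finset.sum_add_distrib]

/-- `F` is a counital cohomomorphism with `F 1 = 1`. -/
structure IsCohom (F : TensorAlgebra k V →ₗ[k] TensorAlgebra k W) : Prop where
  map_comul : comul k W ∘ₗ F = TensorProduct.map F F ∘ₗ comul k V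
  map_counit : counit k W ∘ₗ F = counit k V
  map_one : F 1 = 1

/-- `D` is a coderivation over `F` and `G`: `Δ D = (F ⊗ D + D ⊗ G) Δ` without signs. -/
def IsCoder (F G D : TensorAlgebra k V →ₗ[k] TensorAlgebra k W) : Prop :=
  comul k W ∘ₗ D = (TensorProduct.map F D + TensorProduct.map D G) ∘ₗ comul k V

lemma IsCohom.id : IsCohom (LinearMap.id : TensorAlgebra k V →ₗ[k] TensorAlgebra k V) :=
  ⟨by simp, by simp, rfl⟩

lemma IsCohom.comp {G : TensorAlgebra k W →ₗ[k] TensorAlgebra k U}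
    {F : TensorAlgebra k V →ₗ[k] TensorAlgebra k W} (hG : IsCohom G) (hF : IsCohom F) :
    IsCohom (G ∘ₗ F) where
  map_comul := by
    rw [← LinearMap.comp_assoc, hG.map_comul, LinearMap.comp_assoc, hF.map_comul,
      ← LinearMap.comp_assoc, ← TensorProduct.map_comp]
  map_counit := by rw [← LinearMap.comp_assoc, hG.map_counit, hF.map_counit]
  map_one := by simp [hF.map_one, hG.map_one]

lemma IsCoder.comp_right {F G D : TensorAlgebra k W →ₗ[k] TensorAlgebra k U}
    (hD : IsCoder F G D) {P : TensorAlgebra k V →ₗ[k] TensorAlgebra k W} (hP : IsCohom P) :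
    IsCoder (F ∘ₗ P) (G ∘ₗ P) (D ∘ₗ P) := by
  unfold IsCoder at *
  rw [← LinearMap.comp_assoc, hD, LinearMap.comp_assoc, hP.map_comul, ← LinearMap.comp_assoc,
    LinearMap.add_comp, ← TensorProduct.map_comp, ← TensorProduct.map_comp]

lemma IsCoder.comp_left {F G D : TensorAlgebra k V →ₗ[k] TensorAlgebra k W}
    (hD : IsCoder F G D) {P : TensorAlgebra k W →ₗ[k] TensorAlgebra k U} (hP : IsCohom P) :
    IsCoder (P ∘ₗ F) (P ∘ₗ G) (P ∘ₗ D) := by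
  unfold IsCoder at *
  rw [← LinearMap.comp_assoc, hP.map_comul, LinearMap.comp_assoc, hD, ← LinearMap.comp_assoc,
    LinearMap.comp_add, ← TensorProduct.map_comp, ← TensorProduct.map_comp]

lemma IsCoder.add {F G D D' : TensorAlgebra k V →ₗ[k] TensorAlgebra k W}
    (hD : IsCoder F G D) (hD' : IsCoder F G D') : IsCoder F G (D + D') := by
  unfold IsCoder at *
  rw [LinearMap.comp_add, hD, hD', ← LinearMap.add_comp, TensorProduct.map_add_left,
    TensorProduct.map_add_right]
  congr 1; abel

lemma IsCoder.neg {F G D : TensorAlgebra k V →ₗ[k] TensorAlgebra k W}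
    (hD : IsCoder F G D) : IsCoder F G (-D) := by
  unfold IsCoder at *
  rw [LinearMap.comp_neg, hD, ← LinearMap.neg_comp]
  congr 1
  ext x y
  simp [TensorProduct.tmul_neg, TensorProduct.neg_tmul, add_comm]

lemma IsCoder.sub {F G D D' : TensorAlgebra k V →ₗ[k] TensorAlgebra k W}
    (hD : IsCoder F G D) (hD' : IsCoder F G D') : IsCoder F G (D - D') := by
  rw [sub_eq_add_neg]; exact hD.add hD'.neg

/-- The telescoping `G ⊗ G - F ⊗ F = F ⊗ (G - F) + (G - F) ⊗ G`. It turns comparisons of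
cohomomorphisms into statements on coderivations. -/
lemma IsCohom.sub_isCoder {F G : TensorAlgebra k V →ₗ[k] TensorAlgebra k W}
    (hG : IsCohom G) (hF : IsCohom F) : IsCoder F G (G - F) := by
  unfold IsCoder
  rw [LinearMap.comp_sub, hG.map_comul, hF.map_comul, ← LinearMap.sub_comp]
  congr 1
  ext x y
  simp [TensorProduct.tmul_sub, TensorProduct.sub_tmul]

/-- Applying `ε ⊗ ε` to the formula for `Δ D` gives `ε D = ε D + ε D`, because the term `P ⊗ Q` dies
under `ε P = 0`. The extra term is carried along for `exists_transport`, where a map is only known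
to be a coderivation up to such an error. -/
lemma counit_comp_of_comul {F G D P Q : TensorAlgebra k V →ₗ[k] TensorAlgebra k W}
    (hD : comul k W ∘ₗ D =
      (TensorProduct.map F D + TensorProduct.map D G + TensorProduct.map P Q) ∘ₗ comul k V)
    (hF : IsCohom F) (hG : IsCohom G) (hP : counit k W ∘ₗ P = 0) : counit k W ∘ₗ D = 0 := by
  ext x
  have h := counit_tmul_counit_comul (D x)
  have h2 := LinearMap.congr_fun hD x
  simp only [LinearMap.comp_apply] at h2
  rw [h2, LinearMap.add_apply, LinearMap.add_apply, map_add, map_add] at h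
  have h3 : ∀ (X Y : TensorAlgebra k V →ₗ[k] TensorAlgebra k W)
      (t : TensorAlgebra k V ⊗[k] TensorAlgebra k V),
      (LinearMap.mul' k k ∘ₗ TensorProduct.map (counit k W) (counit k W))
        (TensorProduct.map X Y t) =
      LinearMap.mul' k k (TensorProduct.map (counit k W ∘ₗ X) (counit k W ∘ₗ Y) t) := by
    intro X Y t
    rw [LinearMap.comp_apply, ← LinearMap.comp_apply (TensorProduct.map _ _),
      ← TensorProduct.map_comp]
  rw [h3, h3, h3, hF.map_counit, hG.map_counit, hP, TensorProduct.map_zero_left,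
    LinearMap.zero_apply, map_zero, add_zero] at h
  have h5 := LinearMap.congr_fun (convUnit_conv (counit k W ∘ₗ D)) x
  have h6 := LinearMap.congr_fun (conv_convUnit (counit k W ∘ₗ D)) x
  have hu : convUnit (k := k) V k = counit k V := by
    ext x; simp [convUnit]
  simp only [conv, LinearMap.comp_apply, hu] at h5 h6
  rw [h5, h6] at h
  simpa using h

/-- A linear map into the tensor coalgebra that is a coderivation up to a term `P ⊗ Q` is
recovered from its composition with the projection onto `W`. -/
lemma eq_conv_of_comul {F G D P Q : TensorAlgebra k V →ₗ[k] TensorAlgebra k W}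
    (hD : comul k W ∘ₗ D =
      (TensorProduct.map F D + TensorProduct.map D G + TensorProduct.map P Q) ∘ₗ comul k V)
    (hF : IsCohom F) (hG : IsCohom G) (hP : counit k W ∘ₗ P = 0) :
    D = conv F (TensorAlgebra.ι k ∘ₗ proj k W ∘ₗ D) +
      conv D (TensorAlgebra.ι k ∘ₗ proj k W ∘ₗ G) +
      conv P (TensorAlgebra.ι k ∘ₗ proj k W ∘ₗ Q) := by
  have e0 := fun x => LinearMap.congr_fun (counit_comp_of_comul hD hF hG hP) x
  simp only [LinearMap.comp_apply, LinearMap.zero_apply] at e0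
  ext x
  have h := mulProj_comul (D x)
  rw [e0, zero_smul, sub_zero, ← LinearMap.comp_apply (comul k W), hD] at h
  rw [← h]
  have h2 : ∀ (A B : TensorAlgebra k V →ₗ[k] TensorAlgebra k W) (t),
      mulProj (TensorProduct.map A B t) = LinearMap.mul' k (TensorAlgebra k W)
        (TensorProduct.map A (TensorAlgebra.ι k ∘ₗ proj k W ∘ₗ B) t) := by
    intro A B t
    induction t using TensorProduct.induction_on with
    | zero => simp
    | tmul a b => simp [mulProj_tmul]
    | add a b ha hb => simp only [map_add, ha, hb]
  simp only [LinearMap.comp_apply, LinearMap.add_apply, map_add, h2, conv]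

lemma IsCoder.comul_eq {F G D : TensorAlgebra k V →ₗ[k] TensorAlgebra k W}
    (hD : IsCoder F G D) : comul k W ∘ₗ D =
      (TensorProduct.map F D + TensorProduct.map D G +
        TensorProduct.map (0 : TensorAlgebra k V →ₗ[k] TensorAlgebra k W) 0) ∘ₗ comul k V := by
  rw [hD]
  congr 1
  refine TensorProduct.ext' fun x y => ?_
  simp

lemma IsCoder.counit_comp {F G D : TensorAlgebra k V →ₗ[k] TensorAlgebra k W}
    (hD : IsCoder F G D) (hF : IsCohom F) (hG : IsCohom G) : counit k W ∘ₗ D = 0 :=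
  counit_comp_of_comul hD.comul_eq hF hG (LinearMap.comp_zero _)

/-- A coderivation is recovered from its composition with the projection onto `W`. -/
lemma IsCoder.eq_conv {F G D : TensorAlgebra k V →ₗ[k] TensorAlgebra k W}
    (hD : IsCoder F G D) (hF : IsCohom F) (hG : IsCohom G) :
    D = conv F (TensorAlgebra.ι k ∘ₗ proj k W ∘ₗ D) +
      conv D (TensorAlgebra.ι k ∘ₗ proj k W ∘ₗ G) := by
  have := eq_conv_of_comul hD.comul_eq hF hG (LinearMap.comp_zero _)
  rwa [zero_conv, add_zero] at this

/-- A linear map with vanishing component that is a coderivation up to a term `P ⊗ Q` vanishes on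
words with one letter more than those on which `Q` vanishes. -/
lemma agreeBelow_of_comul {F G D P Q : TensorAlgebra k V →ₗ[k] TensorAlgebra k W}
    (hD : comul k W ∘ₗ D =
      (TensorProduct.map F D + TensorProduct.map D G + TensorProduct.map P Q) ∘ₗ comul k V)
    (hF : IsCohom F) (hG : IsCohom G) (hP : counit k W ∘ₗ P = 0) (hP1 : P 1 = 0)
    (h : proj k W ∘ₗ D = 0) {n : ℕ} (hQ : AgreeBelow n Q 0) : AgreeBelow (n + 1) D 0 := by
  intro l hl
  induction hm : l.length using Nat.strong_induction_on generalizing l with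
  | _ m ih =>
    rw [eq_conv_of_comul hD hF hG hP, h, LinearMap.comp_zero, conv_zero, zero_add,
      LinearMap.add_apply, conv_word, conv_word, LinearMap.zero_apply]
    rw [Finset.sum_eq_zero, Finset.sum_eq_zero, add_zero]
    · intro j hj
      rw [Finset.mem_range] at hj
      rcases j with _ | j
      · simp [word_nil, hP1]
      · simp [hQ (l.drop (j + 1)) (by simp; omega)]
    · intro j hj
      rw [Finset.mem_range] at hj
      -- The full prefix leaves `G` the empty word, on which its component vanishes; every other
      -- prefix is proper and falls under the induction hypothesis.
      by_cases hjl : j = l.length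
      · subst hjl
        simp [word_nil, hG.map_one, proj_one]
      · rw [ih j (by omega) (l.take j) (by simp; omega) (by simp; omega)]
        simp

/-- In `D = F * ι π D + D * ι π G` the first term vanishes by hypothesis, and the second involves
`D` on proper prefixes only. -/
lemma IsCoder.agreeBelow {F G D : TensorAlgebra k V →ₗ[k] TensorAlgebra k W}
    (hD : IsCoder F G D) (hF : IsCohom F) (hG : IsCohom G) {n : ℕ}
    (h : AgreeBelow n (proj k W ∘ₗ D) 0) : AgreeBelow n D 0 := by
  intro l hl
  induction hm : l.length using Nat.strong_induction_on generalizing l with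
  | _ m ih =>
    rw [hD.eq_conv hF hG, LinearMap.add_apply, conv_word, conv_word, LinearMap.zero_apply]
    rw [Finset.sum_eq_zero, Finset.sum_eq_zero, add_zero]
    · intro j hj
      rw [Finset.mem_range] at hj
      by_cases hjl : j = l.length
      · subst hjl
        simp [word_nil, hG.map_one, proj_one]
      · rw [ih j (by omega) (l.take j) (by simp; omega) (by simp; omega)]
        simp
    · intro j hj
      have := h (l.drop j) (by simp; omega)
      simp only [LinearMap.comp_apply, LinearMap.zero_apply] at this
      simp [this]

/-- On a word of length at most `n`, the only surviving term is the one in which `F` takes the empty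
prefix and the component takes the whole word, so the value is a single letter. -/
lemma IsCoder.agreeBelow_succ {F G D : TensorAlgebra k V →ₗ[k] TensorAlgebra k W}
    (hD : IsCoder F G D) (hF : IsCohom F) (hG : IsCohom G) {n : ℕ}
    (h : AgreeBelow n (proj k W ∘ₗ D) 0) :
    AgreeBelow (n + 1) D (TensorAlgebra.ι k ∘ₗ proj k W ∘ₗ D) := by
  intro l hl
  have h0 := hD.agreeBelow hF hG h
  conv_lhs => rw [hD.eq_conv hF hG, LinearMap.add_apply, conv_word, conv_word]
  rw [Finset.sum_range_succ', Finset.sum_eq_zero, Finset.sum_eq_zero]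
  · simp [word_nil, hF.map_one]
  · intro j hj
    rw [Finset.mem_range] at hj
    by_cases hjl : j = l.length
    · subst hjl
      simp [word_nil, hG.map_one, proj_one]
    · rw [h0 (l.take j) (by simp; omega)]
      simp
  · intro j hj
    rw [Finset.mem_range] at hj
    have := h (l.drop (j + 1)) (by simp; omega)
    simp only [LinearMap.comp_apply, LinearMap.zero_apply] at this
    simp [this]

lemma IsCoder.eq_zero {F G D : TensorAlgebra k V →ₗ[k] TensorAlgebra k W}
    (hD : IsCoder F G D) (hF : IsCohom F) (hG : IsCohom G)
    (h : proj k W ∘ₗ D = 0) : D = 0 :=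
  eq_of_agreeBelow fun _ => hD.agreeBelow hF hG (fun l _ => by rw [h])

lemma IsCohom.ext {F G : TensorAlgebra k V →ₗ[k] TensorAlgebra k W}
    (hF : IsCohom F) (hG : IsCohom G) (h : proj k W ∘ₗ F = proj k W ∘ₗ G) : F = G :=
  sub_eq_zero.mp ((hF.sub_isCoder hG).eq_zero hG hF (by rw [LinearMap.comp_sub, h, sub_self]))

lemma IsCoder.ext {F G D D' : TensorAlgebra k V →ₗ[k] TensorAlgebra k W}
    (hD : IsCoder F G D) (hD' : IsCoder F G D') (hF : IsCohom F) (hG : IsCohom G)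
    (h : proj k W ∘ₗ D = proj k W ∘ₗ D') : D = D' :=
  sub_eq_zero.mp ((hD.sub hD').eq_zero hF hG (by rw [LinearMap.comp_sub, h, sub_self]))

/-- The higher part `f - f₁ π` of a linear map `f`, where `f₁` is its restriction to `V`. -/
def higher (f : TensorAlgebra k V →ₗ[k] W) : TensorAlgebra k V →ₗ[k] W :=
  f - (f ∘ₗ TensorAlgebra.ι k) ∘ₗ proj k V

lemma higher_ι (f : TensorAlgebra k V →ₗ[k] W) (v : V) :
    higher f (TensorAlgebra.ι k v) = 0 := by
  simp [higher, proj_ι]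

/-- The higher part of `f` applied to a coderivation `D` depends only on shorter words. -/
lemma IsCoder.higher_agreeBelow {F G D : TensorAlgebra k V →ₗ[k] TensorAlgebra k W}
    (hD : IsCoder F G D) (hF : IsCohom F) (hG : IsCohom G) {n : ℕ}
    (h : AgreeBelow n (proj k W ∘ₗ D) 0) (f : TensorAlgebra k W →ₗ[k] U) :
    AgreeBelow (n + 1) (higher f ∘ₗ D) 0 := by
  intro l hl
  -- The value of `D` here is a single letter, and the higher part of `f` kills letters.
  rw [LinearMap.comp_apply, hD.agreeBelow_succ hF hG h l hl]
  simp [higher_ι]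

/-- The map `φ`, made to vanish at `1`. -/
def reduced (φ : TensorAlgebra k V →ₗ[k] W) : TensorAlgebra k V →ₗ[k] W :=
  φ - (counit k V).smulRight (φ 1)

lemma reduced_one (φ : TensorAlgebra k V →ₗ[k] W) : reduced φ 1 = 0 := by
  simp [reduced, counit_one]

lemma reduced_eq {φ : TensorAlgebra k V →ₗ[k] W} (h : φ 1 = 0) : reduced φ = φ := by
  ext; simp [reduced, h]

lemma AgreeBelow.reduced {n : ℕ} {φ ψ : TensorAlgebra k V →ₗ[k] W} (h : AgreeBelow n φ ψ) :
    AgreeBelow n (reduced φ) (reduced ψ) := by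
  intro l hl
  have h1 : φ 1 = ψ 1 := h [] (by simp; omega)
  simp [AInf.reduced, h l hl, h1]

/-- The recursion whose fixed point is the cohomomorphism with component `φ`. -/
def cohomStep (φ : TensorAlgebra k V →ₗ[k] W) (F : TensorAlgebra k V →ₗ[k] TensorAlgebra k W) :
    TensorAlgebra k V →ₗ[k] TensorAlgebra k W :=
  -- The fixed point is a geometric series: the word is cut into nonempty blocks and `φ` is applied
  -- to each of them.
  convUnit V (TensorAlgebra k W) + conv (TensorAlgebra.ι k ∘ₗ reduced φ) F

lemma contracting_cohomStep (φ : TensorAlgebra k V →ₗ[k] W) : Contracting (cohomStep φ) := by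
  intro n f g h l hl
  simp only [cohomStep, LinearMap.add_apply]
  rw [AgreeBelow.conv_left (by simp [reduced_one]) h l hl]

/-- The cohomomorphism with component `φ` (made to vanish at `1`). -/
def cohomOf (φ : TensorAlgebra k V →ₗ[k] W) : TensorAlgebra k V →ₗ[k] TensorAlgebra k W :=
  fix (cohomStep φ)

lemma cohomOf_eq (φ : TensorAlgebra k V →ₗ[k] W) :
    cohomOf φ = convUnit V (TensorAlgebra k W) +
      conv (TensorAlgebra.ι k ∘ₗ reduced φ) (cohomOf φ) :=
  (contracting_cohomStep φ).fix_eq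

lemma cohomOf_one (φ : TensorAlgebra k V →ₗ[k] W) : cohomOf φ 1 = 1 := by
  rw [cohomOf_eq]
  simp [convUnit_one, conv_one, reduced_one]

lemma counit_mul_eq (x y : TensorAlgebra k V) :
    counit k V (x * y) = counit k V x * counit k V y := by simp [counit]

lemma counit_ι (v : V) : counit k V (TensorAlgebra.ι k v) = 0 := by
  simpa using counit_ι_mul (k := k) v 1

/-- To leave a single letter, `F` must contribute a scalar, which by counitality happens only on the
empty suffix. -/
lemma proj_comp_conv (φ : TensorAlgebra k V →ₗ[k] W)
    (F : TensorAlgebra k V →ₗ[k] TensorAlgebra k W) (hF : counit k W ∘ₗ F = counit k V) :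
    proj k W ∘ₗ conv (TensorAlgebra.ι k ∘ₗ φ) F = φ := by
  have hc := fun x => LinearMap.congr_fun hF x
  simp only [LinearMap.comp_apply] at hc
  refine ext_word fun l => ?_
  rw [LinearMap.comp_apply, conv_word, map_sum, Finset.sum_range_succ, Finset.sum_eq_zero]
  · simp [proj_ι_mul, hc, word_nil, counit_one]
  · intro j hj
    rw [Finset.mem_range] at hj
    obtain ⟨v, l', hl⟩ := List.exists_cons_of_ne_nil
      (show l.drop j ≠ [] by simpa using hj)
    simp [proj_ι_mul, hc, hl, counit_word_cons]

lemma counit_comp_cohomOf (φ : TensorAlgebra k V →ₗ[k] W) :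
    counit k W ∘ₗ cohomOf φ = counit k V := by
  refine ext_word fun l => ?_
  rw [cohomOf_eq, LinearMap.comp_apply, LinearMap.add_apply, map_add, conv_word, map_sum,
    Finset.sum_eq_zero (by intro j _; simp [counit_mul_eq, counit_ι])]
  simp [convUnit, counit]

lemma proj_comp_cohomOf (φ : TensorAlgebra k V →ₗ[k] W) :
    proj k W ∘ₗ cohomOf φ = reduced φ := by
  rw [cohomOf_eq, LinearMap.comp_add, proj_comp_conv _ _ (counit_comp_cohomOf φ)]
  have : proj k W ∘ₗ convUnit V (TensorAlgebra k W) = 0 := by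
    ext x
    simp [convUnit, Algebra.algebraMap_eq_smul_one, proj_one]
  rw [this, zero_add]

/-- With `L` and `R` the inclusions of the two tensor factors, `(F ⊗ F) Δ = L F * R F`. Both this
map and `Δ F` are fixed points of the contraction `X ↦ R F + L f * X`: for the first by the
recursion of `F`, for the second by `comul_conv` and the primitivity of letters. -/
lemma isCohom_cohomOf (φ : TensorAlgebra k V →ₗ[k] W) : IsCohom (cohomOf φ) where
  map_counit := counit_comp_cohomOf φ
  map_one := cohomOf_one φ
  map_comul := by
    rw [map_comp_comul]
    set F := cohomOf φ with hF
    set L := (incL k W).toLinearMap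
    set R := (incR k W).toLinearMap
    set f := TensorAlgebra.ι k ∘ₗ reduced φ with hf
    have hL : L ∘ₗ F = convUnit V _ + conv (L ∘ₗ f) (L ∘ₗ F) := by
      conv_lhs => rw [hF, cohomOf_eq, LinearMap.comp_add, algHom_comp_conv]
      congr 1
    have hR : R ∘ₗ F = convUnit V _ + conv (R ∘ₗ f) (R ∘ₗ F) := by
      conv_lhs => rw [hF, cohomOf_eq, LinearMap.comp_add, algHom_comp_conv]
      congr 1
      ext x
      simp only [R, convUnit, LinearMap.comp_apply, Algebra.linearMap_apply,
        AlgHom.toLinearMap_apply, AlgHom.commutes]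
    have hΔ : comul k W ∘ₗ f = L ∘ₗ f + R ∘ₗ f := by
      ext x
      simp [hf, comul_ι, L, R, add_comm]
    have step : Contracting fun X : TensorAlgebra k V →ₗ[k]
        TensorAlgebra k W ⊗[k] TensorAlgebra k W => R ∘ₗ F + conv (L ∘ₗ f) X := by
      intro n X Y h l hl
      simp only [LinearMap.add_apply]
      rw [AgreeBelow.conv_left (by simp [hf, reduced_one]) h l hl]
    refine step.unique ?_ ?_
    · conv_lhs => rw [hF, cohomOf_eq, LinearMap.comp_add, ← hF, ← hf, comul_conv, hΔ, add_conv]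
      have : comul k W ∘ₗ convUnit V (TensorAlgebra k W) = convUnit V _ := by
        ext x
        simp [convUnit, Algebra.algebraMap_eq_smul_one, comul_one, Algebra.TensorProduct.one_def]
      rw [this]
      conv_rhs => rw [hR]
      abel
    · conv_lhs => rw [hL, add_conv, convUnit_conv, conv_assoc]

lemma cohomOf_agreeBelow {n : ℕ} {φ ψ : TensorAlgebra k V →ₗ[k] W} (h : AgreeBelow n φ ψ) :
    AgreeBelow n (cohomOf φ) (cohomOf ψ) := by
  rw [← agreeBelow_sub_zero]
  refine ((isCohom_cohomOf φ).sub_isCoder (isCohom_cohomOf ψ)).agreeBelow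
    (isCohom_cohomOf ψ) (isCohom_cohomOf φ) ?_
  rw [LinearMap.comp_sub, proj_comp_cohomOf, proj_comp_cohomOf, agreeBelow_sub_zero]
  exact h.reduced

lemma higher_cohomOf_agreeBelow {n : ℕ} {φ ψ : TensorAlgebra k V →ₗ[k] W} (h : AgreeBelow n φ ψ)
    (f : TensorAlgebra k W →ₗ[k] U) :
    AgreeBelow (n + 1) (higher f ∘ₗ cohomOf φ) (higher f ∘ₗ cohomOf ψ) := by
  rw [← agreeBelow_sub_zero, ← LinearMap.comp_sub]
  refine ((isCohom_cohomOf φ).sub_isCoder (isCohom_cohomOf ψ)).higher_agreeBelow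
    (isCohom_cohomOf ψ) (isCohom_cohomOf φ) ?_ f
  rw [LinearMap.comp_sub, proj_comp_cohomOf, proj_comp_cohomOf, agreeBelow_sub_zero]
  exact h.reduced

/-- The coderivation over `F` and `G` with component `h`. -/
def coderOf (F G : TensorAlgebra k V →ₗ[k] TensorAlgebra k W) (h : TensorAlgebra k V →ₗ[k] W) :
    TensorAlgebra k V →ₗ[k] TensorAlgebra k W :=
  conv F (conv (TensorAlgebra.ι k ∘ₗ h) G)

/-- In `F * ι h * G`, the cuts to the left of the letter produced by `h` give `F ⊗ D` and those to
its right give `D ⊗ G`; the overcounts in `comul_conv` cancel the doubled terms. -/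
lemma isCoder_coderOf {F G : TensorAlgebra k V →ₗ[k] TensorAlgebra k W} (hF : IsCohom F)
    (hG : IsCohom G) (h : TensorAlgebra k V →ₗ[k] W) : IsCoder F G (coderOf F G h) := by
  unfold IsCoder coderOf
  rw [LinearMap.add_comp, map_comp_comul, map_comp_comul, algHom_comp_conv, algHom_comp_conv,
    algHom_comp_conv, algHom_comp_conv, comul_conv, comul_conv, algHom_comp_conv, hF.map_comul,
    hG.map_comul, map_comp_comul, map_comp_comul]
  have hΔ : comul k W ∘ₗ (TensorAlgebra.ι k ∘ₗ h) =
      (incL k W).toLinearMap ∘ₗ (TensorAlgebra.ι k ∘ₗ h) +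
      (incR k W).toLinearMap ∘ₗ (TensorAlgebra.ι k ∘ₗ h) := by
    ext x
    simp [comul_ι, add_comm]
  rw [hΔ]
  simp only [conv_add, conv_sub, add_conv, conv_assoc]
  abel

lemma proj_comp_conv_left (F g : TensorAlgebra k V →ₗ[k] TensorAlgebra k W)
    (hF : counit k W ∘ₗ F = counit k V) (hg : counit k W ∘ₗ g = 0) :
    proj k W ∘ₗ conv F g = proj k W ∘ₗ g := by
  -- The projection onto letters is a derivation along the counit. Since `g` has no scalar part,
  -- only the term with the counit of `F` survives.
  have hp : ∀ x y : TensorAlgebra k W,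
      proj k W (x * y) = counit k W x • proj k W y + counit k W y • proj k W x := by
    intro x y
    induction x using word_induction with
    | one => simp [counit_one, proj_one]
    | add a b ha hb => simp only [add_mul, map_add, ha, hb, add_smul, smul_add]; abel
    | smul c a ha =>
      simp only [smul_mul_assoc, map_smul, ha, smul_add, smul_assoc]
      rw [smul_comm c (counit k W y)]
    | ι_mul v a ha =>
      rw [mul_assoc, proj_ι_mul, proj_ι_mul, counit_mul_eq, counit_ι_mul, zero_smul, zero_add,
        smul_smul, mul_comm]
  have hFx := fun x => LinearMap.congr_fun hF x
  have hgx := fun x => LinearMap.congr_fun hg x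
  simp only [LinearMap.comp_apply, LinearMap.zero_apply] at hFx hgx
  refine ext_word fun l => ?_
  rw [LinearMap.comp_apply, conv_word, map_sum, Finset.sum_range_succ', Finset.sum_eq_zero]
  · simp [hp, hFx, hgx, word_nil, counit_one]
  · intro j hj
    rw [Finset.mem_range] at hj
    obtain ⟨v, l', hl⟩ := List.exists_cons_of_ne_nil
      (show l.take (j + 1) ≠ [] by
        intro h
        have := congrArg List.length h
        simp at this
        subst this
        simp at hj)
    simp [hp, hFx, hgx, hl, counit_word_cons]

lemma proj_comp_coderOf {F G : TensorAlgebra k V →ₗ[k] TensorAlgebra k W} (hF : IsCohom F)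
    (hG : IsCohom G) (h : TensorAlgebra k V →ₗ[k] W) : proj k W ∘ₗ coderOf F G h = h := by
  rw [coderOf, proj_comp_conv_left _ _ hF.map_counit, proj_comp_conv _ _ hG.map_counit]
  refine ext_word fun l => ?_
  simp [conv_word, counit_mul_eq, counit_ι]

lemma coderOf_one {F G : TensorAlgebra k V →ₗ[k] TensorAlgebra k W}
    {h : TensorAlgebra k V →ₗ[k] W} (h1 : h 1 = 0) : coderOf F G h 1 = 0 := by
  simp [coderOf, conv_one, h1]

lemma coderOf_agreeBelow {F G : TensorAlgebra k V →ₗ[k] TensorAlgebra k W} (hF : IsCohom F)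
    (hG : IsCohom G) {n : ℕ} {h h' : TensorAlgebra k V →ₗ[k] W} (hh : AgreeBelow n h h')
    (f : TensorAlgebra k W →ₗ[k] U) :
    AgreeBelow (n + 1) (higher f ∘ₗ coderOf F G h) (higher f ∘ₗ coderOf F G h') := by
  rw [← agreeBelow_sub_zero, ← LinearMap.comp_sub]
  refine ((isCoder_coderOf hF hG h).sub (isCoder_coderOf hF hG h')).higher_agreeBelow hF hG ?_ f
  rw [LinearMap.comp_sub, proj_comp_coderOf hF hG, proj_comp_coderOf hF hG, agreeBelow_sub_zero]
  exact hh

/-- The strict cohomomorphism induced by a linear map. -/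
def strictMap (f : V →ₗ[k] W) : TensorAlgebra k V →ₗ[k] TensorAlgebra k W :=
  cohomOf (f ∘ₗ proj k V)

lemma isCohom_strictMap (f : V →ₗ[k] W) : IsCohom (strictMap f) := isCohom_cohomOf _

lemma proj_comp_strictMap (f : V →ₗ[k] W) : proj k W ∘ₗ strictMap f = f ∘ₗ proj k V := by
  rw [strictMap, proj_comp_cohomOf, reduced_eq (by simp [proj_one])]

end Coderivations

end AInf
end

noncomputable section

namespace AInf

/-! ### Degrees of components and of the maps built from them -/

section Degrees

variable {k : Type*} [Field k]
  {V : Type*} [AddCommGroup V] [Module k V] {𝒱 : ℤ → Submodule k V}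
  {W : Type*} [AddCommGroup W] [Module k W] {𝒲 : ℤ → Submodule k W}
  {U : Type*} [AddCommGroup U] [Module k U] {𝒰 : ℤ → Submodule k U}

/-- A word in homogeneous letters. -/
def hword (𝒱 : ℤ → Submodule k V) (l : List (Σ e : ℤ, 𝒱 e)) : TensorAlgebra k V :=
  word k (l.map fun o => (o.2 : V))

/-- The degree of a word in homogeneous letters. -/
def hdeg (l : List (Σ e : ℤ, 𝒱 e)) : ℤ := (l.map Sigma.fst).sum

lemma hword_nil : hword 𝒱 [] = 1 := rfl

lemma hdeg_nil : hdeg ([] : List (Σ e : ℤ, 𝒱 e)) = 0 := rfl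

lemma hword_cons (o : Σ e : ℤ, 𝒱 e) (l : List (Σ e : ℤ, 𝒱 e)) :
    hword 𝒱 (o :: l) = TensorAlgebra.ι k (o.2 : V) * hword 𝒱 l := by
  simp [hword, word_cons]

lemma hdeg_cons (o : Σ e : ℤ, 𝒱 e) (l : List (Σ e : ℤ, 𝒱 e)) :
    hdeg (o :: l) = o.1 + hdeg l := by simp [hdeg]

lemma hdeg_append (l l' : List (Σ e : ℤ, 𝒱 e)) : hdeg (l ++ l') = hdeg l + hdeg l' := by
  simp [hdeg]

lemma hword_append (l l' : List (Σ e : ℤ, 𝒱 e)) :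
    hword 𝒱 (l ++ l') = hword 𝒱 l * hword 𝒱 l' := by
  simp [hword, word_append]

lemma hdeg_take_add_drop (l : List (Σ e : ℤ, 𝒱 e)) (j : ℕ) :
    hdeg (l.take j) + hdeg (l.drop j) = hdeg l := by
  rw [← hdeg_append, List.take_append_drop]

lemma tensorDeg_eq (d : ℤ) :
    tensorDeg 𝒱 d = Submodule.span k {x | ∃ l, hdeg l = d ∧ x = hword 𝒱 l} := by
  simp [tensorDeg, hdeg, hword, word, Function.comp_def]

lemma hword_mem (l : List (Σ e : ℤ, 𝒱 e)) : hword 𝒱 l ∈ tensorDeg 𝒱 (hdeg l) := by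
  rw [tensorDeg_eq]
  exact Submodule.subset_span ⟨l, rfl, rfl⟩

lemma one_mem_tensorDeg : (1 : TensorAlgebra k V) ∈ tensorDeg 𝒱 0 := hword_mem (𝒱 := 𝒱) []

lemma ι_mem_tensorDeg {v : V} {d : ℤ} (hv : v ∈ 𝒱 d) :
    TensorAlgebra.ι k v ∈ tensorDeg 𝒱 d := by
  have := hword_mem (𝒱 := 𝒱) [⟨d, ⟨v, hv⟩⟩]
  simpa [hword_cons, hword_nil, hdeg_cons, hdeg_nil] using this

lemma map_mem_of_mem_tensorDeg {X : Type*} [AddCommGroup X] [Module k X] {S : Submodule k X}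
    {d : ℤ} {f : TensorAlgebra k V →ₗ[k] X}
    (h : ∀ l : List (Σ e : ℤ, 𝒱 e), hdeg l = d → f (hword 𝒱 l) ∈ S) {x : TensorAlgebra k V}
    (hx : x ∈ tensorDeg 𝒱 d) : f x ∈ S := by
  rw [tensorDeg_eq] at hx
  induction hx using Submodule.span_induction with
  | zero => simp
  | add x y _ _ hx hy => rw [map_add]; exact S.add_mem hx hy
  | smul c x _ hx => rw [map_smul]; exact S.smul_mem c hx
  | mem x hx => obtain ⟨l, hl, rfl⟩ := hx; exact h l hl

lemma hasDegree_iff {r : ℤ} {f : TensorAlgebra k V →ₗ[k] TensorAlgebra k W} :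
    HasDegree 𝒱 𝒲 r f ↔ ∀ l, f (hword 𝒱 l) ∈ tensorDeg 𝒲 (hdeg l + r) := by
  refine ⟨fun h l => h _ _ (hword_mem l), fun h d x hx => ?_⟩
  refine map_mem_of_mem_tensorDeg (fun l hl => ?_) hx
  rw [← hl]
  exact h l

lemma mul_mem_tensorDeg {a b : ℤ} {x y : TensorAlgebra k V} (hx : x ∈ tensorDeg 𝒱 a)
    (hy : y ∈ tensorDeg 𝒱 b) : x * y ∈ tensorDeg 𝒱 (a + b) := by
  refine map_mem_of_mem_tensorDeg (f := LinearMap.mulRight k y) (fun l hl => ?_) hx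
  refine map_mem_of_mem_tensorDeg (f := LinearMap.mulLeft k (hword 𝒱 l)) (fun l' hl' => ?_) hy
  rw [LinearMap.mulLeft_apply, ← hword_append, ← hl, ← hl', ← hdeg_append]
  exact hword_mem _

/-- A linear map from the tensor coalgebra to a graded vector space has degree `r`. -/
def CompDegree (𝒱 : ℤ → Submodule k V) (𝒲 : ℤ → Submodule k W) (r : ℤ)
    (f : TensorAlgebra k V →ₗ[k] W) : Prop :=
  ∀ l, f (hword 𝒱 l) ∈ 𝒲 (hdeg l + r)

/-- A linear map between graded vector spaces has degree `r`. -/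
def LinDegree (𝒱 : ℤ → Submodule k V) (𝒲 : ℤ → Submodule k W) (r : ℤ) (f : V →ₗ[k] W) : Prop :=
  ∀ d, ∀ v ∈ 𝒱 d, f v ∈ 𝒲 (d + r)

lemma compDegree_proj : CompDegree 𝒱 𝒱 0 (proj k V) := by
  intro l
  rw [add_zero]
  rcases l with _ | ⟨o, _ | ⟨o', l⟩⟩
  · simp [hword_nil, proj_one]
  · simp [hword_cons, hword_nil, proj_ι, hdeg_cons, hdeg_nil]
  · simp [hword_cons, proj_ι_mul, counit_ι_mul]

lemma CompDegree.comp {f : TensorAlgebra k W →ₗ[k] U} {g : TensorAlgebra k V →ₗ[k] TensorAlgebra k W}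
    {r s t : ℤ} (hf : CompDegree 𝒲 𝒰 r f) (hg : HasDegree 𝒱 𝒲 s g) (ht : s + r = t) :
    CompDegree 𝒱 𝒰 t (f ∘ₗ g) := by
  intro l
  rw [← ht, ← add_assoc]
  refine map_mem_of_mem_tensorDeg (f := f) (fun l' hl' => ?_) (hasDegree_iff.1 hg l)
  rw [← hl']
  exact hf l'

lemma LinDegree.comp_compDegree {f : W →ₗ[k] U} {g : TensorAlgebra k V →ₗ[k] W}
    {r s t : ℤ} (hf : LinDegree 𝒲 𝒰 r f) (hg : CompDegree 𝒱 𝒲 s g) (ht : s + r = t) :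
    CompDegree 𝒱 𝒰 t (f ∘ₗ g) := by
  intro l
  rw [← ht, ← add_assoc]
  exact hf _ _ (hg l)

lemma CompDegree.comp_ι {f : TensorAlgebra k V →ₗ[k] W} {r : ℤ} (hf : CompDegree 𝒱 𝒲 r f) :
    LinDegree 𝒱 𝒲 r (f ∘ₗ TensorAlgebra.ι k) := by
  intro d v hv
  have := hf [⟨d, ⟨v, hv⟩⟩]
  simpa [hword_cons, hword_nil, hdeg_cons, hdeg_nil] using this

lemma LinDegree.comp {f : W →ₗ[k] U} {g : V →ₗ[k] W}
    {r s t : ℤ} (hf : LinDegree 𝒲 𝒰 r f) (hg : LinDegree 𝒱 𝒲 s g) (ht : s + r = t) :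
    LinDegree 𝒱 𝒰 t (f ∘ₗ g) := by
  intro d v hv
  rw [← ht, ← add_assoc]
  exact hf _ _ (hg d v hv)

lemma LinDegree.sub {f g : V →ₗ[k] W} {r : ℤ} (hf : LinDegree 𝒱 𝒲 r f)
    (hg : LinDegree 𝒱 𝒲 r g) : LinDegree 𝒱 𝒲 r (f - g) :=
  fun d v hv => (𝒲 _).sub_mem (hf d v hv) (hg d v hv)

lemma linDegree_id : LinDegree 𝒱 𝒱 0 (LinearMap.id : V →ₗ[k] V) := by
  intro d v hv; simpa using hv

lemma CompDegree.add {f g : TensorAlgebra k V →ₗ[k] W} {r : ℤ} (hf : CompDegree 𝒱 𝒲 r f)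
    (hg : CompDegree 𝒱 𝒲 r g) : CompDegree 𝒱 𝒲 r (f + g) :=
  fun l => (𝒲 _).add_mem (hf l) (hg l)

lemma CompDegree.sub {f g : TensorAlgebra k V →ₗ[k] W} {r : ℤ} (hf : CompDegree 𝒱 𝒲 r f)
    (hg : CompDegree 𝒱 𝒲 r g) : CompDegree 𝒱 𝒲 r (f - g) :=
  fun l => (𝒲 _).sub_mem (hf l) (hg l)

lemma CompDegree.neg {f : TensorAlgebra k V →ₗ[k] W} {r : ℤ} (hf : CompDegree 𝒱 𝒲 r f) :
    CompDegree 𝒱 𝒲 r (-f) :=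
  fun l => (𝒲 _).neg_mem (hf l)

lemma compDegree_zero (r : ℤ) : CompDegree 𝒱 𝒲 r 0 := fun _ => (𝒲 _).zero_mem

lemma CompDegree.higher {f : TensorAlgebra k V →ₗ[k] W} {r : ℤ} (hf : CompDegree 𝒱 𝒲 r f) :
    CompDegree 𝒱 𝒲 r (higher f) :=
  hf.sub (hf.comp_ι.comp_compDegree compDegree_proj (zero_add r))

lemma HasDegree.comp {f : TensorAlgebra k W →ₗ[k] TensorAlgebra k U}
    {g : TensorAlgebra k V →ₗ[k] TensorAlgebra k W}
    {r s t : ℤ} (hf : HasDegree 𝒲 𝒰 r f) (hg : HasDegree 𝒱 𝒲 s g) (ht : s + r = t) :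
    HasDegree 𝒱 𝒰 t (f ∘ₗ g) := by
  intro d v hv
  rw [← ht, ← add_assoc]
  exact hf _ _ (hg d v hv)

lemma hasDegree_id : HasDegree 𝒱 𝒱 0 (LinearMap.id : TensorAlgebra k V →ₗ[k] _) := by
  intro d v hv; simpa using hv

lemma HasDegree.compDegree {f : TensorAlgebra k V →ₗ[k] TensorAlgebra k W} {r : ℤ}
    (hf : HasDegree 𝒱 𝒲 r f) : CompDegree 𝒱 𝒲 r (proj k W ∘ₗ f) :=
  compDegree_proj.comp hf (add_zero r)

lemma CompDegree.ι_comp {f : TensorAlgebra k V →ₗ[k] W} {r : ℤ} (hf : CompDegree 𝒱 𝒲 r f) :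
    HasDegree 𝒱 𝒲 r (TensorAlgebra.ι k ∘ₗ f) :=
  hasDegree_iff.2 fun l => ι_mem_tensorDeg (hf l)

lemma HasDegree.conv {f g : TensorAlgebra k V →ₗ[k] TensorAlgebra k W} {r s t : ℤ}
    (hf : HasDegree 𝒱 𝒲 r f) (hg : HasDegree 𝒱 𝒲 s g) (ht : r + s = t) :
    HasDegree 𝒱 𝒲 t (conv f g) := by
  refine hasDegree_iff.2 fun l => ?_
  rw [hword, conv_word]
  refine Submodule.sum_mem _ fun j _ => ?_
  rw [← List.map_take, ← List.map_drop, ← ht, ← hdeg_take_add_drop l j, add_add_add_comm]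
  exact mul_mem_tensorDeg (hasDegree_iff.1 hf _) (hasDegree_iff.1 hg _)

lemma HasDegree.add {f g : TensorAlgebra k V →ₗ[k] TensorAlgebra k W} {r : ℤ}
    (hf : HasDegree 𝒱 𝒲 r f) (hg : HasDegree 𝒱 𝒲 r g) : HasDegree 𝒱 𝒲 r (f + g) :=
  fun d x hx => (tensorDeg 𝒲 _).add_mem (hf d x hx) (hg d x hx)

lemma hasDegree_convUnit : HasDegree 𝒱 𝒲 0 (convUnit V (TensorAlgebra k W)) := by
  refine hasDegree_iff.2 fun l => ?_
  rcases l with _ | ⟨o, l⟩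
  · rw [hword_nil, convUnit_one]
    exact one_mem_tensorDeg
  · rw [hword, List.map_cons, convUnit_cons]
    exact Submodule.zero_mem _

lemma hasDegree_fix
    {Φ : (TensorAlgebra k V →ₗ[k] TensorAlgebra k W) → (TensorAlgebra k V →ₗ[k] TensorAlgebra k W)}
    {r : ℤ} (h : ∀ f, HasDegree 𝒱 𝒲 r f → HasDegree 𝒱 𝒲 r (Φ f)) :
    HasDegree 𝒱 𝒲 r (fix Φ) := by
  have key : ∀ n, HasDegree 𝒱 𝒲 r (Φ^[n] 0) := by
    intro n
    induction n with
    | zero => intro d x _; simp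
    | succ n ih => rw [Function.iterate_succ_apply']; exact h _ ih
  refine hasDegree_iff.2 fun l => ?_
  rw [hword, fix_word]
  exact hasDegree_iff.1 (key _) l

lemma compDegree_fix {Φ : (TensorAlgebra k V →ₗ[k] W) → (TensorAlgebra k V →ₗ[k] W)}
    {r : ℤ} (h : ∀ f, CompDegree 𝒱 𝒲 r f → CompDegree 𝒱 𝒲 r (Φ f)) :
    CompDegree 𝒱 𝒲 r (fix Φ) := by
  have key : ∀ n, CompDegree 𝒱 𝒲 r (Φ^[n] 0) := by
    intro n
    induction n with
    | zero => exact compDegree_zero r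
    | succ n ih => rw [Function.iterate_succ_apply']; exact h _ ih
  intro l
  rw [hword, fix_word]
  exact key _ l

lemma CompDegree.reduced {f : TensorAlgebra k V →ₗ[k] W} (hf : CompDegree 𝒱 𝒲 0 f) :
    CompDegree 𝒱 𝒲 0 (reduced f) := by
  refine hf.sub fun l => ?_
  rcases l with _ | ⟨o, l⟩
  · have := hf []
    rw [hword_nil, LinearMap.smulRight_apply, counit_one, one_smul]
    simpa [hword_nil] using this
  · simp [hword_cons, counit_ι_mul]

lemma hasDegree_cohomOf {φ : TensorAlgebra k V →ₗ[k] W} (hφ : CompDegree 𝒱 𝒲 0 φ) :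
    HasDegree 𝒱 𝒲 0 (cohomOf φ) :=
  hasDegree_fix fun _ hf =>
    hasDegree_convUnit.add (hφ.reduced.ι_comp.conv hf (add_zero 0))

lemma hasDegree_coderOf {F G : TensorAlgebra k V →ₗ[k] TensorAlgebra k W}
    {h : TensorAlgebra k V →ₗ[k] W} {r : ℤ} (hF : HasDegree 𝒱 𝒲 0 F) (hG : HasDegree 𝒱 𝒲 0 G)
    (hh : CompDegree 𝒱 𝒲 r h) : HasDegree 𝒱 𝒲 r (coderOf F G h) :=
  hF.conv (hh.ι_comp.conv hG (add_zero r)) (zero_add r)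

lemma hasDegree_strictMap {f : V →ₗ[k] W} (hf : LinDegree 𝒱 𝒲 0 f) :
    HasDegree 𝒱 𝒲 0 (strictMap f) :=
  hasDegree_cohomOf (hf.comp_compDegree compDegree_proj (add_zero 0))

end Degrees

/-! ### The Koszul sign as an involution of the coalgebra -/

section Signs

variable {k : Type*} [Field k]
  {V : Type*} [AddCommGroup V] [Module k V] {𝒱 : ℤ → Submodule k V} [DirectSum.Decomposition 𝒱]
  {W : Type*} [AddCommGroup W] [Module k W] {𝒲 : ℤ → Submodule k W} [DirectSum.Decomposition 𝒲]

lemma ext_hword {X : Type*} [AddCommGroup X] [Module k X] (𝒱 : ℤ → Submodule k V)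
    [DirectSum.Decomposition 𝒱] {f g : TensorAlgebra k V →ₗ[k] X}
    (h : ∀ l, f (hword 𝒱 l) = g (hword 𝒱 l)) : f = g := by
  have key : ∀ x : TensorAlgebra k V, ∀ l, f (hword 𝒱 l * x) = g (hword 𝒱 l * x) := by
    intro x
    induction x using word_induction with
    | one => intro l; simpa using h l
    | add x y hx hy => intro l; simp only [mul_add, map_add, hx, hy]
    | smul c x hx => intro l; simp only [mul_smul_comm, map_smul, hx]
    | ι_mul v x hx =>
      intro l
      induction v using DirectSum.Decomposition.inductionOn 𝒱 with
      | zero => simp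
      | add v w hv hw => simp only [map_add, add_mul, mul_add, hv, hw]
      | @homogeneous i v =>
        have := hx (l ++ [⟨i, v⟩])
        simpa only [hword_append, hword_cons, hword_nil, mul_one, mul_assoc] using this
  ext x
  simpa [hword_nil] using key x []

lemma koszul_hword (l : List (Σ e : ℤ, 𝒱 e)) :
    koszul 𝒱 (hword 𝒱 l) = ((-1 : k) ^ hdeg l) • hword 𝒱 l :=
  koszul_of_mem 𝒱 (hword_mem l)

lemma koszul_word (l : List V) : koszul 𝒱 (word k l) = word k (l.map (signMap 𝒱)) := by
  induction l with
  | nil => simp [word_nil, koszul_one]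
  | cons v l ih =>
    simp only [koszul, AlgHom.toLinearMap_apply, List.map_cons, word_cons, map_mul] at ih ⊢
    rw [ih]; simp

/-- The sign of a word is the product of the signs of its letters, so the involution respects cuts.
Consequently `F ∘ koszul` is a cohomomorphism and may stand in the left slot of `IsCoder`. -/
lemma isCohom_koszul : IsCohom (koszul 𝒱) where
  map_comul := by
    refine ext_word fun l => ?_
    rw [LinearMap.comp_apply, koszul_word, comul_word, LinearMap.comp_apply, comul_word, map_sum]
    simp [koszul_word]
  map_counit := by
    refine ext_word fun l => ?_
    rw [LinearMap.comp_apply, koszul_word]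
    cases l with
    | nil => rfl
    | cons v l => rw [List.map_cons, counit_word_cons, counit_word_cons]
  map_one := koszul_one 𝒱

lemma koszul_koszul : koszul 𝒱 ∘ₗ koszul 𝒱 = LinearMap.id := by
  refine ext_hword 𝒱 fun l => ?_
  rw [LinearMap.comp_apply, koszul_hword, map_smul, koszul_hword, smul_smul, ← mul_zpow]
  simp

lemma hasDegree_koszul : HasDegree 𝒱 𝒱 0 (koszul 𝒱) := by
  intro d x hx
  rw [koszul_of_mem 𝒱 hx, add_zero]
  exact Submodule.smul_mem _ _ hx

lemma HasDegree.koszul_comp {f : TensorAlgebra k V →ₗ[k] TensorAlgebra k W} {r : ℤ}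
    (hf : HasDegree 𝒱 𝒲 r f) : koszul 𝒲 ∘ₗ f = ((-1 : k) ^ r) • (f ∘ₗ koszul 𝒱) := by
  refine ext_hword 𝒱 fun l => ?_
  rw [LinearMap.comp_apply, koszul_of_mem 𝒲 (hasDegree_iff.1 hf l), LinearMap.smul_apply,
    LinearMap.comp_apply, koszul_hword, map_smul, smul_smul, zpow_add₀ (by simp), mul_comm]

lemma HasDegree.koszul_comp_even {f : TensorAlgebra k V →ₗ[k] TensorAlgebra k W}
    (hf : HasDegree 𝒱 𝒲 0 f) : koszul 𝒲 ∘ₗ f = f ∘ₗ koszul 𝒱 := by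
  rw [hf.koszul_comp]; ext x; simp

lemma HasDegree.koszul_comp_one {f : TensorAlgebra k V →ₗ[k] TensorAlgebra k W}
    (hf : HasDegree 𝒱 𝒲 1 f) : koszul 𝒲 ∘ₗ f = -(f ∘ₗ koszul 𝒱) := by
  rw [hf.koszul_comp]; ext x; simp

lemma HasDegree.koszul_comp_neg_one {f : TensorAlgebra k V →ₗ[k] TensorAlgebra k W}
    (hf : HasDegree 𝒱 𝒲 (-1) f) : koszul 𝒲 ∘ₗ f = -(f ∘ₗ koszul 𝒱) := by
  rw [hf.koszul_comp]; ext x; simp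

end Signs

end AInf
end

/-! ### A∞-morphisms and strict homotopies -/

noncomputable section

namespace AInf

variable {k : Type*} [Field k]
  {V : Type*} [AddCommGroup V] [Module k V] {𝒱 : ℤ → Submodule k V} [DirectSum.Decomposition 𝒱]
  {W : Type*} [AddCommGroup W] [Module k W] {𝒲 : ℤ → Submodule k W} [DirectSum.Decomposition 𝒲]
  {U : Type*} [AddCommGroup U] [Module k U] {𝒰 : ℤ → Submodule k U} [DirectSum.Decomposition 𝒰]
  {A : AInfAlgebra 𝒱} {B : AInfAlgebra 𝒲} {C : AInfAlgebra 𝒰}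

/-- The involution in the left slot absorbs the Koszul sign: an odd coderivation over `F` and `G` is
a coderivation without signs over `F ∘ koszul` and `G`. The reconstruction lemmas thus serve even
and odd maps alike. -/
lemma AInfAlgebra.isCoder (A : AInfAlgebra 𝒱) : IsCoder (koszul 𝒱) LinearMap.id A.m := by
  unfold IsCoder
  rw [A.coderivation, add_comm]
  rfl

lemma AInfAlgebra.m_m (A : AInfAlgebra 𝒱) (x : TensorAlgebra k V) : A.m (A.m x) = 0 :=
  LinearMap.congr_fun A.sq_zero x

lemma AInfAlgebra.linDegree_m1 (A : AInfAlgebra 𝒱) : LinDegree 𝒱 𝒱 1 A.m1 :=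
  A.degree_one.compDegree.comp_ι

/-- The components `m₂, m₃, …`. -/
def AInfAlgebra.mHigher (A : AInfAlgebra 𝒱) : TensorAlgebra k V →ₗ[k] V := higher (proj k V ∘ₗ A.m)

lemma AInfAlgebra.proj_m (A : AInfAlgebra 𝒱) (x : TensorAlgebra k V) :
    proj k V (A.m x) = A.m1 (proj k V x) + A.mHigher x := by
  simp [mHigher, higher, AInfAlgebra.m1]

namespace AInfHom

lemma isCohom (F : AInfHom A B) : IsCohom F.F := ⟨F.map_comul, F.map_counit, F.map_one⟩

lemma linDegree_f1 (F : AInfHom A B) : LinDegree 𝒱 𝒲 0 F.f1 :=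
  F.degree_zero.compDegree.comp_ι

/-- The components `f₂, f₃, …`. -/
def fHigher (F : AInfHom A B) : TensorAlgebra k V →ₗ[k] W := higher (proj k W ∘ₗ F.F)

lemma proj_F (F : AInfHom A B) (x : TensorAlgebra k V) :
    proj k W (F.F x) = F.f1 (proj k V x) + F.fHigher x := by
  simp [fHigher, higher, AInfHom.f1]

lemma comm_apply (F : AInfHom A B) (x : TensorAlgebra k V) : F.F (A.m x) = B.m (F.F x) :=
  LinearMap.congr_fun F.comm x

lemma ext_F {F G : AInfHom A B} (h : F.F = G.F) : F = G := by
  cases F; cases G; cases h; rfl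

/-- A homogeneous cohomomorphism of degree zero that commutes with the codifferentials. -/
def ofCohom (F : TensorAlgebra k V →ₗ[k] TensorAlgebra k W) (hF : IsCohom F)
    (hd : HasDegree 𝒱 𝒲 0 F) (hm : F ∘ₗ A.m = B.m ∘ₗ F) : AInfHom A B where
  F := F
  degree_zero := hd
  map_comul := hF.map_comul
  map_counit := hF.map_counit
  f_zero := by rw [hF.map_one, proj_one]
  comm := hm

end AInfHom

/-- Both terms are coderivations over the same pair once the sign is moved past `F`. Commutation
with the codifferentials can therefore be tested on components. -/
lemma isCoder_commutator {F : TensorAlgebra k V →ₗ[k] TensorAlgebra k W} (hF : IsCohom F)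
    (hd : HasDegree 𝒱 𝒲 0 F) :
    IsCoder (F ∘ₗ koszul 𝒱) F (B.m ∘ₗ F - F ∘ₗ A.m) := by
  refine IsCoder.sub ?_ ?_
  · rw [← hd.koszul_comp_even]
    exact B.isCoder.comp_right hF
  · exact A.isCoder.comp_left hF

/-- Since `B.m` and `H` are odd, the mixed terms cancel, except for the failure of `G` to commute
with the codifferentials. That commutation is not assumed, because in `exists_transport` the map `G`
is not yet known to be a morphism. -/
lemma comul_homotopy {F G H : TensorAlgebra k V →ₗ[k] TensorAlgebra k W}
    (hFd : HasDegree 𝒱 𝒲 0 F) (hFm : F ∘ₗ A.m = B.m ∘ₗ F)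
    (hHd : HasDegree 𝒱 𝒲 (-1) H) (hH : IsCoder (F ∘ₗ koszul 𝒱) G H) :
    comul k W ∘ₗ (B.m ∘ₗ H + H ∘ₗ A.m) =
      (TensorProduct.map F (B.m ∘ₗ H + H ∘ₗ A.m) + TensorProduct.map (B.m ∘ₗ H + H ∘ₗ A.m) G -
        TensorProduct.map (H ∘ₗ koszul 𝒱) (B.m ∘ₗ G - G ∘ₗ A.m)) ∘ₗ comul k V := by
  have h1 : comul k W ∘ₗ B.m ∘ₗ H =
      ((TensorProduct.map (koszul 𝒲) B.m + TensorProduct.map B.m LinearMap.id) ∘ₗ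
      (TensorProduct.map (F ∘ₗ koszul 𝒱) H + TensorProduct.map H G)) ∘ₗ comul k V := by
    rw [← LinearMap.comp_assoc, B.isCoder, LinearMap.comp_assoc, hH, LinearMap.comp_assoc]
  have h2 : comul k W ∘ₗ H ∘ₗ A.m =
      ((TensorProduct.map (F ∘ₗ koszul 𝒱) H + TensorProduct.map H G) ∘ₗ
      (TensorProduct.map (koszul 𝒱) A.m + TensorProduct.map A.m LinearMap.id)) ∘ₗ comul k V := by
    rw [← LinearMap.comp_assoc, hH, LinearMap.comp_assoc, A.isCoder, LinearMap.comp_assoc]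
  rw [LinearMap.comp_add, h1, h2, ← LinearMap.add_comp]
  congr 1
  have s1 := fun x => LinearMap.congr_fun hFd.koszul_comp_even x
  have s2 := fun x => LinearMap.congr_fun hHd.koszul_comp_neg_one x
  have s3 := fun x => LinearMap.congr_fun A.degree_one.koszul_comp_one x
  have s4 := fun x => LinearMap.congr_fun (koszul_koszul (𝒱 := 𝒱)) x
  have s5 := fun x => LinearMap.congr_fun hFm x
  simp only [LinearMap.comp_apply, LinearMap.neg_apply, LinearMap.id_apply] at s1 s2 s3 s4 s5
  refine TensorProduct.ext' fun x y => ?_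
  simp only [LinearMap.add_apply, LinearMap.sub_apply, LinearMap.comp_apply,
    TensorProduct.map_tmul, map_add, s1, s2, s3, s4, LinearMap.id_apply, ← s5, map_neg,
    TensorProduct.tmul_add, TensorProduct.add_tmul, TensorProduct.tmul_sub,
    TensorProduct.neg_tmul]
  abel

lemma isCoder_homotopy {F G H : TensorAlgebra k V →ₗ[k] TensorAlgebra k W}
    (hFd : HasDegree 𝒱 𝒲 0 F) (hFm : F ∘ₗ A.m = B.m ∘ₗ F)
    (hGm : G ∘ₗ A.m = B.m ∘ₗ G)
    (hHd : HasDegree 𝒱 𝒲 (-1) H) (hH : IsCoder (F ∘ₗ koszul 𝒱) G H) :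
    IsCoder F G (B.m ∘ₗ H + H ∘ₗ A.m) := by
  unfold IsCoder
  rw [comul_homotopy hFd hFm hHd hH, hGm, sub_self]
  congr 1
  refine TensorProduct.ext' fun x y => ?_
  simp

namespace AInfHom

lemma strictlyHomotopic_iff {F G : AInfHom A B} :
    StrictlyHomotopic G F ↔ ∃ H : TensorAlgebra k V →ₗ[k] TensorAlgebra k W,
      HasDegree 𝒱 𝒲 (-1) H ∧ G.F - F.F = B.m ∘ₗ H + H ∘ₗ A.m ∧
      IsCoder (F.F ∘ₗ koszul 𝒱) G.F H ∧ H 1 = 0 :=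
  ⟨fun ⟨H, ⟨h1, h2⟩, h3, h4⟩ => ⟨H, h1, h2, h3, h4⟩,
    fun ⟨H, h1, h2, h3, h4⟩ => ⟨H, ⟨h1, h2⟩, h3, h4⟩⟩

/-- A homotopy operator is determined by its component. -/
lemma strictlyHomotopic_of_component {F G : AInfHom A B} {h : TensorAlgebra k V →ₗ[k] W}
    (hd : CompDegree 𝒱 𝒲 (-1) h) (h1 : h 1 = 0)
    (heq : ∀ x, proj k W (G.F x) - proj k W (F.F x) =
      proj k W (B.m (coderOf (F.F ∘ₗ koszul 𝒱) G.F h x)) + h (A.m x)) :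
    StrictlyHomotopic G F := by
  have hFκ := F.isCohom.comp (isCohom_koszul (𝒱 := 𝒱))
  have hc := isCoder_coderOf hFκ G.isCohom h
  have hdeg : HasDegree 𝒱 𝒲 (-1) (coderOf (F.F ∘ₗ koszul 𝒱) G.F h) :=
    hasDegree_coderOf (F.degree_zero.comp hasDegree_koszul (add_zero 0)) G.degree_zero hd
  refine strictlyHomotopic_iff.2 ⟨_, hdeg, ?_, hc, coderOf_one h1⟩
  refine (G.isCohom.sub_isCoder F.isCohom).ext
    (isCoder_homotopy F.degree_zero F.comm G.comm hdeg hc)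
    F.isCohom G.isCohom ?_
  have hp := fun x => LinearMap.congr_fun (proj_comp_coderOf hFκ G.isCohom h) x
  simp only [LinearMap.comp_apply] at hp
  ext x : 1
  simp [heq, hp]

/-- The operator is composed along with the morphisms. This and `comp_right` are the only closure
properties of strict homotopy that the argument uses; neither symmetry nor transitivity enters. -/
lemma StrictlyHomotopic.comp_left {F G : AInfHom A B} (h : StrictlyHomotopic G F)
    (K : AInfHom B C) : StrictlyHomotopic (K.comp G) (K.comp F) := by
  rw [strictlyHomotopic_iff] at h ⊢
  obtain ⟨H, h1, h2, h3, h4⟩ := h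
  refine ⟨K.F ∘ₗ H, K.degree_zero.comp h1 (add_zero _), ?_, ?_, by simp [h4]⟩
  · change K.F ∘ₗ G.F - K.F ∘ₗ F.F = _
    rw [← LinearMap.comp_sub, h2, LinearMap.comp_add, ← LinearMap.comp_assoc, K.comm,
      LinearMap.comp_assoc, LinearMap.comp_assoc]
  · exact h3.comp_left K.isCohom

lemma StrictlyHomotopic.comp_right {F G : AInfHom B C} (h : StrictlyHomotopic G F)
    (K : AInfHom A B) : StrictlyHomotopic (G.comp K) (F.comp K) := by
  rw [strictlyHomotopic_iff] at h ⊢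
  obtain ⟨H, h1, h2, h3, h4⟩ := h
  refine ⟨H ∘ₗ K.F, h1.comp K.degree_zero (zero_add _), ?_, ?_, by simp [h4, K.map_one]⟩
  · change G.F ∘ₗ K.F - F.F ∘ₗ K.F = _
    rw [← LinearMap.sub_comp, h2, LinearMap.add_comp, LinearMap.comp_assoc, LinearMap.comp_assoc,
      ← K.comm, ← LinearMap.comp_assoc]
    rfl
  · change IsCoder ((F.F ∘ₗ K.F) ∘ₗ koszul 𝒱) _ _
    -- The involution has to pass through the even map `K` to reach the source of `H`.
    rw [LinearMap.comp_assoc, ← K.degree_zero.koszul_comp_even, ← LinearMap.comp_assoc]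
    exact h3.comp_right K.isCohom

lemma StrictlyHomotopic.homotopic {F G : AInfHom A B} (h : StrictlyHomotopic G F) :
    Homotopic G F := by
  obtain ⟨H, h, -⟩ := h
  exact ⟨H, h⟩

/-- The linear part of a strict homotopy. -/
lemma StrictlyHomotopic.linear {F G : AInfHom A B} (h : StrictlyHomotopic G F) :
    ∃ h1 : V →ₗ[k] W, ∀ v, G.f1 v - F.f1 v = B.m1 (h1 v) + h1 (A.m1 v) := by
  obtain ⟨H, ⟨-, h2⟩, h3, h4⟩ := h
  -- Because `H 1 = 0` while `F` and `G` fix `1`, the image of a letter under `H` is primitive,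
  -- hence a letter.
  have hι : ∀ v, H (TensorAlgebra.ι k v) =
      TensorAlgebra.ι k (proj k W (H (TensorAlgebra.ι k v))) := by
    intro v
    have := LinearMap.congr_fun h3 (TensorAlgebra.ι k v)
    simp only [LinearMap.comp_apply, comul_ι, LinearMap.add_apply, map_add, TensorProduct.map_tmul,
      oddTensor, koszul_one, h4, F.map_one, G.map_one, TensorProduct.zero_tmul,
      TensorProduct.tmul_zero, add_zero, zero_add] at this
    exact eq_ι_of_primitive this
  refine ⟨proj k W ∘ₗ H ∘ₗ TensorAlgebra.ι k, fun v => ?_⟩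
  have := LinearMap.congr_fun h2 (TensorAlgebra.ι k v)
  simp only [LinearMap.sub_apply, LinearMap.add_apply, LinearMap.comp_apply, F_ι,
    AInfAlgebra.m_ι] at this
  rw [hι v, AInfAlgebra.m_ι] at this
  have := congrArg (proj k W) this
  simpa [proj_ι] using this

lemma comp_f1 (G : AInfHom B C) (F : AInfHom A B) (v : V) :
    (G.comp F).f1 v = G.f1 (F.f1 v) := by
  change proj k U (G.F (F.F (TensorAlgebra.ι k v))) = _
  rw [F_ι, F_ι, proj_ι]

lemma id_f1 (v : V) : (AInfHom.id A).f1 v = v := proj_ι v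

lemma cohomologyMap_mk (F : AInfHom A B) (x : LinearMap.ker A.m1) :
    F.cohomologyMap (Submodule.Quotient.mk x) = Submodule.Quotient.mk (F.kerMap x) := rfl

lemma isQuasiIso_iff (F : AInfHom A B) : F.IsQuasiIso ↔
    (∀ v, A.m1 v = 0 → ∀ w, F.f1 v = B.m1 w → ∃ u, v = A.m1 u) ∧
    (∀ w, B.m1 w = 0 → ∃ v u, A.m1 v = 0 ∧ w = F.f1 v + B.m1 u) := by
  unfold IsQuasiIso Function.Bijective
  refine and_congr ?_ ?_
  · rw [injective_iff_map_eq_zero]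
    constructor
    · intro h v hv w hw
      have := h (Submodule.Quotient.mk ⟨v, LinearMap.mem_ker.2 hv⟩) (by
        rw [cohomologyMap_mk,
          Submodule.Quotient.mk_eq_zero]
        exact ⟨w, hw.symm⟩)
      rw [Submodule.Quotient.mk_eq_zero] at this
      obtain ⟨u, hu⟩ := this
      exact ⟨u, hu.symm⟩
    · intro h x hx
      obtain ⟨⟨v, hv⟩, rfl⟩ := Submodule.Quotient.mk_surjective _ x
      rw [cohomologyMap_mk,
        Submodule.Quotient.mk_eq_zero] at hx
      obtain ⟨w, hw⟩ := hx
      obtain ⟨u, hu⟩ := h v hv w hw.symm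
      rw [Submodule.Quotient.mk_eq_zero]
      exact ⟨u, hu.symm⟩
  · constructor
    · intro h w hw
      obtain ⟨x, hx⟩ := h (Submodule.Quotient.mk ⟨w, LinearMap.mem_ker.2 hw⟩)
      obtain ⟨⟨v, hv⟩, rfl⟩ := Submodule.Quotient.mk_surjective _ x
      rw [cohomologyMap_mk, eq_comm,
        Submodule.Quotient.eq] at hx
      obtain ⟨u, hu⟩ := hx
      refine ⟨v, u, hv, ?_⟩
      have hu' : B.m1 u = w - F.f1 v := hu
      rw [hu']; abel
    · intro h x
      obtain ⟨⟨w, hw⟩, rfl⟩ := Submodule.Quotient.mk_surjective _ x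
      obtain ⟨v, u, hv, hu⟩ := h w hw
      refine ⟨Submodule.Quotient.mk ⟨v, LinearMap.mem_ker.2 hv⟩, ?_⟩
      rw [cohomologyMap_mk, eq_comm,
        Submodule.Quotient.eq]
      refine ⟨u, ?_⟩
      change B.m1 u = w - F.f1 v
      rw [hu]; abel

/-- Only linear parts matter: `g₁ f₁` and `f₁ g₁` are chain homotopic to the identities through `a`
and `b`. -/
lemma IsStrictHomotopyEquiv.isQuasiIso {F : AInfHom A B} (h : F.IsStrictHomotopyEquiv) :
    F.IsQuasiIso := by
  obtain ⟨G, hGF, hFG⟩ := h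
  obtain ⟨a, ha⟩ := hGF.linear
  obtain ⟨b, hb⟩ := hFG.linear
  simp only [comp_f1, id_f1] at ha hb
  rw [isQuasiIso_iff]
  constructor
  · intro v hv w hw
    have h1 := ha v
    rw [hv, map_zero, add_zero, hw, G.f1_m1] at h1
    refine ⟨G.f1 w - a v, ?_⟩
    rw [map_sub, ← h1]; abel
  · intro w hw
    have h1 := hb w
    rw [hw, map_zero, add_zero] at h1
    refine ⟨G.f1 w, -b w, by rw [← G.f1_m1, hw, map_zero], ?_⟩
    rw [map_neg, ← h1]; abel

end AInfHom

end AInf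
end

/-! ### Inverting a morphism along a strong deformation retraction -/

noncomputable section

namespace AInf

variable {k : Type*} [Field k]
  {V : Type*} [AddCommGroup V] [Module k V] {𝒱 : ℤ → Submodule k V} [DirectSum.Decomposition 𝒱]
  {W : Type*} [AddCommGroup W] [Module k W] {𝒲 : ℤ → Submodule k W} [DirectSum.Decomposition 𝒲]
  {A : AInfAlgebra 𝒱} {B : AInfAlgebra 𝒲}

/-- A strong deformation retraction of the complex `(V, m₁)` onto `(W, m₁')` whose projection is
the linear part of the `A∞`-morphism `F`. -/
structure Retraction (F : AInfHom A B) where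
  /-- the inclusion -/
  g : W →ₗ[k] V
  /-- the contracting homotopy -/
  s : V →ₗ[k] V
  degree_g : LinDegree 𝒲 𝒱 0 g
  degree_s : LinDegree 𝒱 𝒱 (-1) s
  f_g : ∀ w, F.f1 (g w) = w
  homotopy : ∀ v, A.m1 (s v) + s (A.m1 v) = v - g (F.f1 v)
  f_s : ∀ v, F.f1 (s v) = 0
  s_g : ∀ w, s (g w) = 0
  s_s : ∀ v, s (s v) = 0

namespace Retraction

variable {F : AInfHom A B} (r : Retraction F)

/-- The recursion for the component of a right inverse of `F`. -/
def invStep (φ : TensorAlgebra k W →ₗ[k] V) : TensorAlgebra k W →ₗ[k] V :=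
  -- Applying `f₁` leaves the bracket, which encodes `F G = 1`; applying `s` gives zero, a gauge
  -- condition. The last term is the one that makes `G` commute with the codifferentials.
  r.g ∘ₗ (proj k W - F.fHigher ∘ₗ cohomOf φ) - r.s ∘ₗ (A.mHigher ∘ₗ cohomOf φ)

/-- Only higher components are applied to `cohomOf φ`, and on a given word these see `φ` on shorter
words. -/
lemma contracting_invStep : Contracting r.invStep := by
  intro n φ ψ h l hl
  have h1 := higher_cohomOf_agreeBelow h (proj k W ∘ₗ F.F) l hl
  have h2 := higher_cohomOf_agreeBelow h (proj k V ∘ₗ A.m) l hl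
  simp only [LinearMap.comp_apply] at h1 h2
  simp only [invStep, LinearMap.sub_apply, LinearMap.comp_apply, AInfHom.fHigher,
    AInfAlgebra.mHigher, h1, h2]

/-- The component of a right inverse of `F`. -/
def invComp : TensorAlgebra k W →ₗ[k] V := fix r.invStep

lemma invComp_eq (x : TensorAlgebra k W) :
    r.invComp x = r.g (proj k W x - F.fHigher (cohomOf r.invComp x)) -
      r.s (A.mHigher (cohomOf r.invComp x)) :=
  LinearMap.congr_fun r.contracting_invStep.fix_eq x

lemma degree_invComp : CompDegree 𝒲 𝒱 0 r.invComp := by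
  refine compDegree_fix fun φ hφ => ?_
  have hG := hasDegree_cohomOf hφ
  have hF := F.degree_zero.compDegree.higher.comp hG (add_zero 0)
  have hA := A.degree_one.compDegree.higher.comp hG (zero_add 1)
  exact (r.degree_g.comp_compDegree (compDegree_proj.sub hF) (add_zero 0)).sub
    (r.degree_s.comp_compDegree hA (by norm_num))

lemma invComp_one : r.invComp 1 = 0 := by
  have h1 := F.proj_F 1
  have h2 := A.proj_m 1
  rw [F.map_one, proj_one, proj_one, map_zero, zero_add] at h1
  rw [A.m_one, map_zero, proj_one, map_zero, zero_add] at h2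
  rw [invComp_eq, cohomOf_one, ← h1, ← h2, proj_one]
  simp

lemma proj_inv (x : TensorAlgebra k W) : proj k V (cohomOf r.invComp x) = r.invComp x := by
  have := LinearMap.congr_fun (proj_comp_cohomOf r.invComp) x
  rwa [reduced_eq r.invComp_one] at this

lemma s_invComp (x : TensorAlgebra k W) : r.s (r.invComp x) = 0 := by
  rw [invComp_eq, map_sub, r.s_g, r.s_s, sub_zero]

lemma f_invComp (x : TensorAlgebra k W) :
    F.f1 (r.invComp x) = proj k W x - F.fHigher (cohomOf r.invComp x) := by
  rw [invComp_eq, map_sub, r.f_g, r.f_s, sub_zero]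

lemma F_comp_inv : F.F ∘ₗ cohomOf r.invComp = LinearMap.id := by
  refine (F.isCohom.comp (isCohom_cohomOf _)).ext IsCohom.id ?_
  ext x : 1
  simp only [LinearMap.comp_apply, LinearMap.id_apply]
  rw [F.proj_F, proj_inv, f_invComp, sub_add_cancel]

lemma F_inv (x : TensorAlgebra k W) : F.F (cohomOf r.invComp x) = x :=
  LinearMap.congr_fun r.F_comp_inv x

lemma decomp (v : V) : v = r.g (F.f1 v) + A.m1 (r.s v) + r.s (A.m1 v) := by
  rw [add_assoc, r.homotopy]; abel

/-- The defect `D = m G - G m'` is a coderivation with `F D = 0`, `s π D = 0` and `m D = -D m'`.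
Decomposing `π D` along the retraction gives `π D = -g f_{≥2} D - s m_{≥2} D`, whose right side
depends only on `π D` on shorter words; so `D = 0`. -/
lemma inv_comm : cohomOf r.invComp ∘ₗ B.m = A.m ∘ₗ cohomOf r.invComp := by
  set G := cohomOf r.invComp with hGdef
  have hG : IsCohom G := isCohom_cohomOf _
  have hGd : HasDegree 𝒲 𝒱 0 G := hasDegree_cohomOf r.degree_invComp
  set D := A.m ∘ₗ G - G ∘ₗ B.m with hD
  have hDx : ∀ x, D x = A.m (G x) - G (B.m x) := fun x => rfl
  have hcod : IsCoder (G ∘ₗ koszul 𝒲) G D := isCoder_commutator hG hGd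
  have hGκ := hG.comp (isCohom_koszul (𝒱 := 𝒲))
  have hFD : ∀ x, F.f1 (proj k V (D x)) = -F.fHigher (D x) := by
    intro x
    have h0 : F.F (D x) = 0 := by
      rw [hDx, map_sub, F.comm_apply, r.F_inv, r.F_inv, sub_self]
    have h1 := F.proj_F (D x)
    rw [h0, map_zero] at h1
    exact eq_neg_of_add_eq_zero_left h1.symm
  have hE : ∀ x, proj k V (D x) = A.m1 (r.invComp x) + A.mHigher (G x) - r.invComp (B.m x) := by
    intro x
    rw [hDx, map_sub, A.proj_m, r.proj_inv, r.proj_inv]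
  -- As `s φ = 0`, the decomposition reads `φ = g f₁ φ + s m₁ φ`; comparison with the recursion for
  -- `φ` yields `s m₁ φ = -s m_{≥2} G`.
  have hsE : ∀ x, r.s (proj k V (D x)) = 0 := by
    intro x
    have h1 := r.decomp (r.invComp x)
    rw [r.s_invComp, map_zero, add_zero, r.f_invComp] at h1
    have h2 := r.invComp_eq x
    have h3 : r.s (A.m1 (r.invComp x)) = -r.s (A.mHigher (G x)) := by
      rw [sub_eq_add_neg] at h2
      exact add_left_cancel (h1.symm.trans h2)
    rw [hE, map_sub, map_add, r.s_invComp, h3, neg_add_cancel, sub_zero]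
  have hdE : ∀ x, A.m1 (proj k V (D x)) = -proj k V (D (B.m x)) - A.mHigher (D x) := by
    intro x
    have h1 : A.m (D x) + D (B.m x) = 0 := by
      simp [hDx, A.m_m, B.m_m]
    have h2 := congrArg (proj k V) h1
    rw [map_add, A.proj_m, map_zero] at h2
    rw [← sub_eq_zero, ← h2]; abel
  have hrec : ∀ x, proj k V (D x) = -r.g (F.fHigher (D x)) - r.s (A.mHigher (D x)) := by
    intro x
    conv_lhs => rw [r.decomp (proj k V (D x))]
    rw [hFD, hsE, hdE, map_sub, map_neg, map_neg, hsE, map_zero, neg_zero]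
    abel
  have hz : D = 0 := by
    refine hcod.eq_zero hGκ hG (eq_of_agreeBelow_succ fun n hn l hl => ?_)
    have h1 := hcod.higher_agreeBelow hGκ hG hn (proj k W ∘ₗ F.F) l hl
    have h2 := hcod.higher_agreeBelow hGκ hG hn (proj k V ∘ₗ A.m) l hl
    simp only [LinearMap.comp_apply, LinearMap.zero_apply] at h1 h2
    simp [hrec, AInfHom.fHigher, AInfAlgebra.mHigher, h1, h2]
  exact (sub_eq_zero.1 hz).symm

/-- The right inverse of `F`. -/
def inv : AInfHom B A :=
  AInfHom.ofCohom (cohomOf r.invComp) (isCohom_cohomOf _) (hasDegree_cohomOf r.degree_invComp)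
    r.inv_comm

lemma comp_inv : F.comp r.inv = AInfHom.id B := AInfHom.ext_F r.F_comp_inv

/-- The coderivation over the identity and `F⁻¹ F` with component `h`. -/
def hCoder (h : TensorAlgebra k V →ₗ[k] V) : TensorAlgebra k V →ₗ[k] TensorAlgebra k V :=
  coderOf (LinearMap.id ∘ₗ koszul 𝒱) (r.inv.F ∘ₗ F.F) h

/-- The recursion for the component of the homotopy. -/
def homStep (h : TensorAlgebra k V →ₗ[k] V) : TensorAlgebra k V →ₗ[k] V :=
  -- The first term forces `f₁ h = -f_{≥2} H`, that is `F H = 0`. The second again satisfies `s h =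
  -- 0`; its summand `s π` accounts for the identity at which the homotopy starts.
  -(r.g ∘ₗ (F.fHigher ∘ₗ r.hCoder h)) - r.s ∘ₗ (proj k V + A.mHigher ∘ₗ r.hCoder h)

lemma isCohom_idκ : IsCohom (LinearMap.id ∘ₗ koszul 𝒱) :=
  IsCohom.id.comp (isCohom_koszul (𝒱 := 𝒱))

lemma isCohom_invF : IsCohom (r.inv.F ∘ₗ F.F) := r.inv.isCohom.comp F.isCohom

lemma contracting_homStep : Contracting r.homStep := by
  intro n φ ψ h l hl
  have h1 := coderOf_agreeBelow (isCohom_idκ (𝒱 := 𝒱)) r.isCohom_invF h (proj k W ∘ₗ F.F) l hl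
  have h2 := coderOf_agreeBelow (isCohom_idκ (𝒱 := 𝒱)) r.isCohom_invF h (proj k V ∘ₗ A.m) l hl
  simp only [LinearMap.comp_apply] at h1 h2
  simp only [homStep, LinearMap.sub_apply, LinearMap.neg_apply, LinearMap.add_apply,
    LinearMap.comp_apply, AInfHom.fHigher, AInfAlgebra.mHigher, hCoder, h1, h2]

/-- The component of the homotopy. -/
def homComp : TensorAlgebra k V →ₗ[k] V := fix r.homStep

lemma homComp_eq (x : TensorAlgebra k V) :
    r.homComp x = -r.g (F.fHigher (r.hCoder r.homComp x)) -
      r.s (proj k V x + A.mHigher (r.hCoder r.homComp x)) :=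
  LinearMap.congr_fun r.contracting_homStep.fix_eq x

lemma hasDegree_hCoder {h : TensorAlgebra k V →ₗ[k] V} (hd : CompDegree 𝒱 𝒱 (-1) h) :
    HasDegree 𝒱 𝒱 (-1) (r.hCoder h) :=
  hasDegree_coderOf (hasDegree_id.comp hasDegree_koszul (add_zero 0))
    (r.inv.degree_zero.comp F.degree_zero (add_zero 0)) hd

lemma degree_homComp : CompDegree 𝒱 𝒱 (-1) r.homComp := by
  refine compDegree_fix fun φ hφ => ?_
  have hG := r.hasDegree_hCoder hφ
  have hF := F.degree_zero.compDegree.higher.comp hG (add_zero _)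
  have hA := A.degree_one.compDegree.higher.comp hG (neg_add_cancel 1)
  exact (r.degree_g.comp_compDegree hF (add_zero _)).neg.sub
    (r.degree_s.comp_compDegree (compDegree_proj.add hA) (zero_add _))

lemma f_homComp (x : TensorAlgebra k V) :
    F.f1 (r.homComp x) = -F.fHigher (r.hCoder r.homComp x) := by
  rw [homComp_eq, map_sub, map_neg, r.f_g, r.f_s, sub_zero]

lemma s_homComp (x : TensorAlgebra k V) : r.s (r.homComp x) = 0 := by
  rw [homComp_eq, map_sub, map_neg, r.s_g, r.s_s, sub_zero, neg_zero]

lemma isCoder_hCoder (h : TensorAlgebra k V →ₗ[k] V) :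
    IsCoder (LinearMap.id ∘ₗ koszul 𝒱) (r.inv.F ∘ₗ F.F) (r.hCoder h) :=
  isCoder_coderOf isCohom_idκ r.isCohom_invF h

lemma proj_hCoder (h : TensorAlgebra k V →ₗ[k] V) (x : TensorAlgebra k V) :
    proj k V (r.hCoder h x) = h x :=
  LinearMap.congr_fun (proj_comp_coderOf isCohom_idκ r.isCohom_invF h) x

/-- `F H` is a coderivation, and its component `f₁ h + f_{≥2} H` vanishes by the recursion. -/
lemma F_hCoder (x : TensorAlgebra k V) : F.F (r.hCoder r.homComp x) = 0 := by
  have : F.F ∘ₗ r.hCoder r.homComp = 0 := by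
    refine ((r.isCoder_hCoder _).comp_left F.isCohom).eq_zero (F.isCohom.comp isCohom_idκ)
      (F.isCohom.comp r.isCohom_invF) ?_
    ext x : 1
    rw [LinearMap.comp_apply, LinearMap.comp_apply, F.proj_F, proj_hCoder, f_homComp]
    simp
  exact LinearMap.congr_fun this x

lemma homComp_one : r.homComp 1 = 0 := by
  have hz : ∀ w : V, F.fHigher (TensorAlgebra.ι k w) = 0 := higher_ι _
  have hz' : ∀ w : V, A.mHigher (TensorAlgebra.ι k w) = 0 := higher_ι _
  -- On the empty word `H` gives a single letter, which the higher parts in the recursion kill; no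
  -- prior knowledge of `r.homComp 1` is needed.
  have h1 : r.hCoder r.homComp 1 = TensorAlgebra.ι k (r.homComp 1) := by
    simp [hCoder, coderOf, conv_one, koszul_one, F.map_one, r.inv.map_one]
  rw [homComp_eq, h1, hz, hz', proj_one]
  simp

/-- The argument of `inv_comm`, applied to the defect `Y = G F - 1 - (m H + H m)`. Here `F Y = 0`
because `F G = 1` and `F H = 0`, while `s π Y = 0` by the gauge conditions, and `Y` commutes with
`m`. -/
theorem strictlyHomotopic : AInfHom.StrictlyHomotopic (r.inv.comp F) (AInfHom.id A) := by
  rw [AInfHom.strictlyHomotopic_iff]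
  set H := r.hCoder r.homComp with hHdef
  have hHd : HasDegree 𝒱 𝒱 (-1) H := r.hasDegree_hCoder r.degree_homComp
  have hH : IsCoder (LinearMap.id ∘ₗ koszul 𝒱) (r.inv.F ∘ₗ F.F) H := r.isCoder_hCoder _
  refine ⟨H, hHd, ?_, hH, coderOf_one r.homComp_one⟩
  set K := r.inv.comp F with hK
  set Y := K.F - (AInfHom.id A).F - (A.m ∘ₗ H + H ∘ₗ A.m) with hY
  have hYx : ∀ x, Y x = r.inv.F (F.F x) - x - (A.m (H x) + H (A.m x)) := fun x => rfl
  have hcod : IsCoder (AInfHom.id A).F K.F Y :=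
    (K.isCohom.sub_isCoder (AInfHom.id A).isCohom).sub
      (isCoder_homotopy (AInfHom.id A).degree_zero (AInfHom.id A).comm K.comm hHd hH)
  have hFinv : ∀ x, F.F (r.inv.F x) = x := r.F_inv
  have hFD : ∀ x, F.f1 (proj k V (Y x)) = -F.fHigher (Y x) := by
    intro x
    have h0 : F.F (Y x) = 0 := by
      have e1 : F.F (H x) = 0 := r.F_hCoder x
      have e2 : F.F (H (A.m x)) = 0 := r.F_hCoder _
      rw [hYx, map_sub, map_sub, hFinv, sub_self, map_add, F.comm_apply, e1, e2]
      simp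
    have h1 := F.proj_F (Y x)
    rw [h0, map_zero] at h1
    exact eq_neg_of_add_eq_zero_left h1.symm
  have hE : ∀ x, proj k V (Y x) = r.invComp (F.F x) - proj k V x -
      (A.m1 (r.homComp x) + A.mHigher (H x) + r.homComp (A.m x)) := by
    intro x
    have e1 : proj k V (r.inv.F (F.F x)) = r.invComp (F.F x) := r.proj_inv _
    rw [hYx, map_sub, map_sub, map_add, A.proj_m, e1, r.proj_hCoder, r.proj_hCoder]
  have hsE : ∀ x, r.s (proj k V (Y x)) = 0 := by
    intro x
    have h1 := r.decomp (r.homComp x)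
    rw [r.s_homComp, map_zero, add_zero, r.f_homComp, map_neg] at h1
    have h2 := r.homComp_eq x
    have h3 : r.s (A.m1 (r.homComp x)) = -r.s (proj k V x + A.mHigher (H x)) := by
      rw [sub_eq_add_neg] at h2
      exact add_left_cancel (h1.symm.trans h2)
    rw [hE]
    simp only [map_sub, map_add] at h3 ⊢
    rw [r.s_invComp, h3, r.s_homComp]
    abel
  have hdE : ∀ x, A.m1 (proj k V (Y x)) = proj k V (Y (A.m x)) - A.mHigher (Y x) := by
    intro x
    have h1 : A.m (Y x) = Y (A.m x) := by
      simp [hYx, A.m_m, F.comm_apply, r.inv.comm_apply]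
    have h2 := A.proj_m (Y x)
    rw [h1] at h2
    rw [h2]; abel
  have hrec : ∀ x, proj k V (Y x) = -r.g (F.fHigher (Y x)) - r.s (A.mHigher (Y x)) := by
    intro x
    conv_lhs => rw [r.decomp (proj k V (Y x))]
    rw [hFD, hsE, hdE, map_sub, map_neg, hsE, map_zero]
    abel
  have hz : Y = 0 := by
    refine hcod.eq_zero (AInfHom.id A).isCohom K.isCohom
      (eq_of_agreeBelow_succ fun n hn l hl => ?_)
    have h1 := hcod.higher_agreeBelow (AInfHom.id A).isCohom K.isCohom hn (proj k W ∘ₗ F.F) l hl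
    have h2 := hcod.higher_agreeBelow (AInfHom.id A).isCohom K.isCohom hn (proj k V ∘ₗ A.m) l hl
    simp only [LinearMap.comp_apply, LinearMap.zero_apply] at h1 h2
    simp [hrec, AInfHom.fHigher, AInfAlgebra.mHigher, h1, h2]
  exact sub_eq_zero.1 hz

end Retraction

end AInf
end

/-! ### Graded linear algebra: existence of the retraction -/

noncomputable section

namespace AInf

section Homogenize

variable {k : Type*} [Field k]
  {V : Type*} [AddCommGroup V] [Module k V] {𝒱 : ℤ → Submodule k V} [DirectSum.Decomposition 𝒱]
  {W : Type*} [AddCommGroup W] [Module k W] {𝒲 : ℤ → Submodule k W} [DirectSum.Decomposition 𝒲]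

/-- The projection onto the degree `d` part of a graded vector space. -/
def projDeg (𝒱 : ℤ → Submodule k V) [DirectSum.Decomposition 𝒱] (d : ℤ) : V →ₗ[k] V :=
  (𝒱 d).subtype ∘ₗ DirectSum.component k ℤ (fun e => 𝒱 e) d ∘ₗ
    (DirectSum.decomposeLinearEquiv 𝒱).toLinearMap

lemma projDeg_apply (d : ℤ) (v : V) : projDeg 𝒱 d v = DirectSum.decompose 𝒱 v d := rfl

lemma projDeg_mem (d : ℤ) (v : V) : projDeg 𝒱 d v ∈ 𝒱 d := by
  rw [projDeg_apply]
  exact SetLike.coe_mem _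

lemma projDeg_of_mem {d : ℤ} {v : V} (hv : v ∈ 𝒱 d) : projDeg 𝒱 d v = v := by
  rw [projDeg_apply, DirectSum.decompose_of_mem_same 𝒱 hv]

lemma projDeg_of_mem_ne {d e : ℤ} (h : e ≠ d) {v : V} (hv : v ∈ 𝒱 e) : projDeg 𝒱 d v = 0 := by
  rw [projDeg_apply, DirectSum.decompose_of_mem_ne 𝒱 hv h]

lemma ext_homogeneous {X : Type*} [AddCommGroup X] [Module k X] (𝒱 : ℤ → Submodule k V)
    [DirectSum.Decomposition 𝒱] {f g : V →ₗ[k] X} (h : ∀ d, ∀ v ∈ 𝒱 d, f v = g v) (v : V) :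
    f v = g v := by
  induction v using DirectSum.Decomposition.inductionOn 𝒱 with
  | zero => simp
  | add v w hv hw => rw [map_add, map_add, hv, hw]
  | homogeneous v => exact h _ v v.2

lemma LinDegree.projDeg_comm {f : V →ₗ[k] W} {r : ℤ} (hf : LinDegree 𝒱 𝒲 r f) {d e : ℤ}
    (he : d + r = e) (v : V) : f (projDeg 𝒱 d v) = projDeg 𝒲 e (f v) := by
  refine ext_homogeneous 𝒱 (f := f ∘ₗ projDeg 𝒱 d) (g := projDeg 𝒲 e ∘ₗ f) (fun c v hv => ?_) v
  simp only [LinearMap.comp_apply]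
  by_cases hc : c = d
  · subst hc
    rw [projDeg_of_mem hv, projDeg_of_mem (he ▸ hf _ _ hv)]
  · rw [projDeg_of_mem_ne hc hv, projDeg_of_mem_ne (by omega) (hf _ _ hv), map_zero]

/-- The degree `r` part of a linear map between graded vector spaces. -/
def homogenize (𝒱 : ℤ → Submodule k V) [DirectSum.Decomposition 𝒱] (𝒲 : ℤ → Submodule k W)
    [DirectSum.Decomposition 𝒲] (r : ℤ) (f : V →ₗ[k] W) : V →ₗ[k] W :=
  DirectSum.toModule k ℤ W (fun d => projDeg 𝒲 (d + r) ∘ₗ f ∘ₗ (𝒱 d).subtype) ∘ₗ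
    (DirectSum.decomposeLinearEquiv 𝒱).toLinearMap

lemma homogenize_of_mem (r : ℤ) (f : V →ₗ[k] W) {d : ℤ} {v : V} (hv : v ∈ 𝒱 d) :
    homogenize 𝒱 𝒲 r f v = projDeg 𝒲 (d + r) (f v) := by
  simp only [homogenize, LinearMap.comp_apply, LinearEquiv.coe_coe,
    DirectSum.decomposeLinearEquiv_apply]
  rw [DirectSum.decompose_of_mem 𝒱 hv, ← DirectSum.lof_eq_of k, DirectSum.toModule_lof]
  simp

lemma linDegree_homogenize (r : ℤ) (f : V →ₗ[k] W) :
    LinDegree 𝒱 𝒲 r (homogenize 𝒱 𝒲 r f) := by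
  intro d v hv
  rw [homogenize_of_mem r f hv]
  exact projDeg_mem _ _

end Homogenize

variable {k : Type*} [Field k]
  {V : Type*} [AddCommGroup V] [Module k V] {𝒱 : ℤ → Submodule k V} [DirectSum.Decomposition 𝒱]
  {W : Type*} [AddCommGroup W] [Module k W] {𝒲 : ℤ → Submodule k W} [DirectSum.Decomposition 𝒲]
  {A : AInfAlgebra 𝒱} {B : AInfAlgebra 𝒲}

/-- A linear section exists over a field, and its degree zero part is still a section because `f` is
homogeneous. -/
lemma exists_graded_section {f : V →ₗ[k] W} (hf : LinDegree 𝒱 𝒲 0 f)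
    (hs : Function.Surjective f) :
    ∃ σ : W →ₗ[k] V, LinDegree 𝒲 𝒱 0 σ ∧ ∀ w, f (σ w) = w := by
  obtain ⟨σ, hσ⟩ := f.exists_rightInverse_of_surjective (LinearMap.range_eq_top.2 hs)
  refine ⟨homogenize 𝒲 𝒱 0 σ, linDegree_homogenize 0 σ, fun w => ?_⟩
  refine ext_homogeneous 𝒲 (f := f ∘ₗ homogenize 𝒲 𝒱 0 σ) (g := LinearMap.id) (fun d w hw => ?_) w
  have := LinearMap.congr_fun hσ w
  simp only [LinearMap.comp_apply, LinearMap.id_apply] at this ⊢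
  rw [homogenize_of_mem 0 σ hw, hf.projDeg_comm (add_zero _), this, add_zero, projDeg_of_mem hw]

/-- A graded generalized inverse of the differential `d` on the kernel of `f`; here `P` is a
projection onto that kernel. -/
lemma exists_graded_inverse {f : V →ₗ[k] W} {d P : V →ₗ[k] V} (hf : LinDegree 𝒱 𝒲 0 f)
    (hd : LinDegree 𝒱 𝒱 1 d) (hP : LinDegree 𝒱 𝒱 0 P) (hfP : ∀ v, f (P v) = 0) :
    ∃ t : V →ₗ[k] V, LinDegree 𝒱 𝒱 (-1) t ∧ (∀ v, f (t v) = 0) ∧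
      ∀ v, d (t (d (P v))) = d (P v) := by
  -- `τ` is a section of `d` from the image of `ker f` back to `ker f`, and `T` extends it to all of
  -- `V`.
  obtain ⟨τ, hτ⟩ := (d ∘ₗ (LinearMap.ker f).subtype).rangeRestrict.exists_rightInverse_of_surjective
    (LinearMap.range_rangeRestrict _)
  obtain ⟨T, hT⟩ := LinearMap.exists_extend τ
  set t : V →ₗ[k] V := (LinearMap.ker f).subtype ∘ₗ T with ht
  have hft : ∀ v, f (t v) = 0 := fun v => (T v).2
  have hdt : ∀ v, d (t (d (P v))) = d (P v) := by
    intro v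
    have hm : d (P v) ∈ LinearMap.range (d ∘ₗ (LinearMap.ker f).subtype) :=
      ⟨⟨P v, hfP v⟩, rfl⟩
    have h1 := LinearMap.congr_fun hT ⟨_, hm⟩
    have h2 : d (τ ⟨_, hm⟩ : V) = d (P v) := congrArg Subtype.val (LinearMap.congr_fun hτ ⟨_, hm⟩)
    simp only [LinearMap.comp_apply, Submodule.subtype_apply] at h1
    rw [← h1] at h2
    exact h2
  -- Passing to the degree `-1` part keeps both identities, since `f`, `d` and `P` are homogeneous.
  refine ⟨homogenize 𝒱 𝒱 (-1) t, linDegree_homogenize _ _, ?_, ?_⟩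
  · refine ext_homogeneous 𝒱 (f := f ∘ₗ homogenize 𝒱 𝒱 (-1) t) (g := 0) fun e v hv => ?_
    rw [LinearMap.comp_apply, homogenize_of_mem _ t hv, hf.projDeg_comm (add_zero _), hft]
    simp
  · refine ext_homogeneous 𝒱 (f := d ∘ₗ homogenize 𝒱 𝒱 (-1) t ∘ₗ d ∘ₗ P) (g := d ∘ₗ P)
      fun e v hv => ?_
    have hm : d (P v) ∈ 𝒱 (e + 0 + 1) := hd _ _ (hP _ _ hv)
    simp only [LinearMap.comp_apply]
    rw [homogenize_of_mem _ t hm, hd.projDeg_comm (e := e + 0 + 1) (by ring), hdt,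
      projDeg_of_mem hm]

/-- A surjective quasi-isomorphism of complexes is part of a strong deformation retraction. -/
theorem Retraction.nonempty (F : AInfHom A B) (hs : Function.Surjective F.f1)
    (hk : ∀ v, F.f1 v = 0 → A.m1 v = 0 → ∃ u, F.f1 u = 0 ∧ A.m1 u = v) :
    Nonempty (Retraction F) := by
  set f := F.f1
  set d := A.m1
  set d' := B.m1
  have hf : LinDegree 𝒱 𝒲 0 f := F.linDegree_f1
  have hd : LinDegree 𝒱 𝒱 1 d := A.linDegree_m1
  have hd' : LinDegree 𝒲 𝒲 1 d' := B.linDegree_m1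
  have dd : ∀ v, d (d v) = 0 := A.m1_m1
  have dd' : ∀ v, d' (d' v) = 0 := B.m1_m1
  have fd : ∀ v, f (d v) = d' (f v) := F.f1_m1
  obtain ⟨σ, hσd, hσ⟩ := exists_graded_section hf hs
  -- `P` is the projection onto `ker f` along the image of `σ`.
  set P : V →ₗ[k] V := LinearMap.id - σ ∘ₗ f with hPdef
  have hPd : LinDegree 𝒱 𝒱 0 P := linDegree_id.sub (hσd.comp hf (add_zero 0))
  have hfP : ∀ v, f (P v) = 0 := fun v => by simp [hPdef, hσ]
  have hP : ∀ v, f v = 0 → P v = v := fun v hv => by simp [hPdef, hv]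
  obtain ⟨t, htd, hft, hdt⟩ := exists_graded_inverse hf hd hPd hfP
  have hz : ∀ z, f z = 0 → d z = 0 → d (t z) = z := by
    intro z h1 h2
    obtain ⟨u, hu, rfl⟩ := hk z h1 h2
    simpa only [hP u hu] using hdt u
  -- For `x` in `ker f`, the element `x - t d x` is a cycle of `ker f`, and `d t` is the identity on
  -- such cycles. Hence `b` contracts `ker f`.
  set b : V →ₗ[k] V := t ∘ₗ (LinearMap.id - t ∘ₗ d) ∘ₗ P with hb
  have hbx : ∀ x, f x = 0 → b x = t (x - t (d x)) := fun x hx => by simp [hb, hP x hx]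
  have hbd : LinDegree 𝒱 𝒱 (-1) b :=
    htd.comp ((linDegree_id.sub (htd.comp hd (by norm_num))).comp hPd (add_zero 0)) (zero_add _)
  have hfb : ∀ x, f (b x) = 0 := fun x => hft _
  have hfdx : ∀ x, f x = 0 → f (d x) = 0 := fun x hx => by rw [fd, hx, map_zero]
  have hhom : ∀ x, f x = 0 → d (b x) + b (d x) = x := by
    intro x hx
    have h1 : d (x - t (d x)) = 0 := by
      rw [map_sub, hz (d x) (hfdx x hx) (dd x), sub_self]
    have h2 : f (x - t (d x)) = 0 := by rw [map_sub, hx, hft, sub_zero]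
    rw [hbx x hx, hz _ h2 h1, hbx _ (hfdx x hx), dd, map_zero, sub_zero, sub_add_cancel]
  have hdbd : ∀ x, f x = 0 → d (b (d x)) = d x := by
    intro x hx
    have := hhom (d x) (hfdx x hx)
    rwa [dd, map_zero, add_zero] at this
  -- Replacing `b` by `b d b` keeps it a contraction and makes its square zero.
  set c : V →ₗ[k] V := b ∘ₗ d ∘ₗ b with hc
  have hcx : ∀ x, c x = b (d (b x)) := fun x => rfl
  have hcd : LinDegree 𝒱 𝒱 (-1) c := hbd.comp (hd.comp hbd (neg_add_cancel 1)) (zero_add _)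
  have hfc : ∀ x, f (c x) = 0 := fun x => hfb _
  have hchom : ∀ x, f x = 0 → d (c x) + c (d x) = x := by
    intro x hx
    rw [hcx, hcx, hdbd _ (hfb x), hdbd _ hx, hhom x hx]
  have hcc : ∀ x, c (c x) = 0 := by
    intro x
    have h1 := hhom (b (d (b x))) (hfb _)
    rw [hdbd _ (hfb x)] at h1
    have h2 : d (b (b (d (b x)))) = 0 := add_eq_right.1 h1
    rw [hcx, hcx, h2, map_zero]
  -- `δ` measures how far `σ` is from a chain map. It takes values in `ker f` and anticommutes with
  -- the differentials, so `σ - c δ` is a section and a chain map.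
  set δ : W →ₗ[k] V := d ∘ₗ σ - σ ∘ₗ d' with hδ
  have hδx : ∀ w, δ w = d (σ w) - σ (d' w) := fun w => rfl
  have hδd : LinDegree 𝒲 𝒱 1 δ := (hd.comp hσd (zero_add 1)).sub (hσd.comp hd' (add_zero 1))
  have hfδ : ∀ w, f (δ w) = 0 := fun w => by rw [hδx, map_sub, fd, hσ, hσ, sub_self]
  set g : W →ₗ[k] V := σ - c ∘ₗ δ with hg
  have hgx : ∀ w, g w = σ w - c (δ w) := fun w => rfl
  have hfg : ∀ w, f (g w) = w := fun w => by rw [hgx, map_sub, hσ, hfc, sub_zero]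
  have hdg : ∀ w, d (g w) = g (d' w) := by
    intro w
    have h1 := hchom (δ w) (hfδ w)
    have h2 : d (δ w) = -δ (d' w) := by
      rw [hδx, hδx, map_sub, dd, dd', map_zero]; abel
    rw [h2, map_neg, ← sub_eq_add_neg, sub_eq_iff_eq_add] at h1
    rw [hgx, map_sub, h1, hgx, hδx w]; abel
  -- The contraction of `ker f`, extended by zero on the image of `g`.
  set s : V →ₗ[k] V := c ∘ₗ (LinearMap.id - g ∘ₗ f) with hsdef
  have hsx : ∀ v, s v = c (v - g (f v)) := fun v => rfl
  have hK : ∀ v, f (v - g (f v)) = 0 := fun v => by rw [map_sub, hfg, sub_self]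
  have hgd : LinDegree 𝒲 𝒱 0 g := hσd.sub (hcd.comp hδd (add_neg_cancel 1))
  refine ⟨⟨g, s, hgd, hcd.comp (linDegree_id.sub (hgd.comp hf (add_zero 0))) (zero_add _), hfg,
    ?_, fun v => hfc _, ?_, ?_⟩⟩
  · intro v
    have h1 := hchom _ (hK v)
    rw [map_sub d, hdg, ← fd] at h1
    exact h1
  · intro w
    rw [hsx]
    rw [hfg, sub_self, map_zero]
  · intro v
    rw [hsx, hsx]
    rw [hfc, map_zero, sub_zero, hcc]

end AInf
end

/-! ### Homotopies with prescribed starting point and component -/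

noncomputable section

namespace AInf

variable {k : Type*} [Field k]
  {V : Type*} [AddCommGroup V] [Module k V] {𝒱 : ℤ → Submodule k V} [DirectSum.Decomposition 𝒱]
  {W : Type*} [AddCommGroup W] [Module k W] {𝒲 : ℤ → Submodule k W} [DirectSum.Decomposition 𝒲]
  {A : AInfAlgebra 𝒱} {B : AInfAlgebra 𝒲}

/-- The recursion for the component of the end point of a homotopy with component `h` that starts
at `F`. -/
def transportStep (F : AInfHom A B) (h ψ : TensorAlgebra k V →ₗ[k] W) :
    TensorAlgebra k V →ₗ[k] W :=
  -- The component of the equation `G = F + m' H + H m`, where `H` itself depends on the unknown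
  -- `G`.
  proj k W ∘ₗ F.F + proj k W ∘ₗ B.m ∘ₗ coderOf (F.F ∘ₗ koszul 𝒱) (cohomOf ψ) h + h ∘ₗ A.m

/-- The unknown enters only through the right factor of `F * ι h * G`, and `h 1 = 0` makes that
factor lose a letter. -/
lemma contracting_transportStep (F : AInfHom A B) {h : TensorAlgebra k V →ₗ[k] W} (h1 : h 1 = 0) :
    Contracting (transportStep F h) := by
  intro n φ ψ hn
  have e : AgreeBelow (n + 1) (coderOf (F.F ∘ₗ koszul 𝒱) (cohomOf φ) h)
      (coderOf (F.F ∘ₗ koszul 𝒱) (cohomOf ψ) h) :=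
    AgreeBelow.conv_congr (fun _ _ => rfl)
      ((cohomOf_agreeBelow hn).conv_left (by simp [h1]))
  intro l hl
  simp only [transportStep, LinearMap.add_apply, LinearMap.comp_apply, e l hl]

/-- A homotopy can be prescribed by its starting point and its component. -/
theorem exists_transport (F : AInfHom A B) {h : TensorAlgebra k V →ₗ[k] W}
    (hd : CompDegree 𝒱 𝒲 (-1) h) (h1 : h 1 = 0) :
    ∃ (G : AInfHom A B) (H : TensorAlgebra k V →ₗ[k] TensorAlgebra k W),
      proj k W ∘ₗ H = h ∧ IsCoder (F.F ∘ₗ koszul 𝒱) G.F H ∧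
      G.F - F.F = B.m ∘ₗ H + H ∘ₗ A.m := by
  set φ := fix (transportStep F h) with hφ
  set G := cohomOf φ with hGdef
  set H := coderOf (F.F ∘ₗ koszul 𝒱) G h with hHdef
  have hG : IsCohom G := isCohom_cohomOf φ
  have hFκ := F.isCohom.comp (isCohom_koszul (𝒱 := 𝒱))
  have hFκd : HasDegree 𝒱 𝒲 0 (F.F ∘ₗ koszul 𝒱) :=
    F.degree_zero.comp hasDegree_koszul (add_zero 0)
  have hH : IsCoder (F.F ∘ₗ koszul 𝒱) G H := isCoder_coderOf hFκ hG h
  have hpH : proj k W ∘ₗ H = h := proj_comp_coderOf hFκ hG h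
  have hH1 : H 1 = 0 := coderOf_one h1
  have hφe : φ = proj k W ∘ₗ F.F + proj k W ∘ₗ B.m ∘ₗ H + h ∘ₗ A.m :=
    (contracting_transportStep F h1).fix_eq
  have hφd : CompDegree 𝒱 𝒲 0 φ := by
    refine compDegree_fix fun ψ hψ => ?_
    have hc := hasDegree_coderOf hFκd (hasDegree_cohomOf hψ) hd
    exact (F.degree_zero.compDegree.add (B.degree_one.compDegree.comp hc (neg_add_cancel 1))).add
      (hd.comp A.degree_one (add_neg_cancel 1))
  have hGd : HasDegree 𝒱 𝒲 0 G := hasDegree_cohomOf hφd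
  have hHd : HasDegree 𝒱 𝒲 (-1) H := hasDegree_coderOf hFκd hGd hd
  have hφ1 : φ 1 = 0 := by
    rw [hφe]
    simp [F.map_one, proj_one, hH1, A.m_one]
  have hpG : proj k W ∘ₗ G = φ := by rw [proj_comp_cohomOf, reduced_eq hφ1]
  -- `Y` is the defect of the homotopy equation and `X` that of `G` being a morphism. By
  -- construction `π Y = 0`, while `X = m' Y - Y m`, and `Y` is a coderivation up to the error `H κ
  -- ⊗ X`. Each controls the other, and the two vanish by a joint induction on length.
  set Y := G - F.F - (B.m ∘ₗ H + H ∘ₗ A.m) with hY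
  have hYx : ∀ x, Y x = G x - F.F x - (B.m (H x) + H (A.m x)) := fun x => rfl
  set X := B.m ∘ₗ G - G ∘ₗ A.m with hX
  have hpY : proj k W ∘ₗ Y = 0 := by
    rw [hY, LinearMap.comp_sub, LinearMap.comp_sub, LinearMap.comp_add, hpG, ← LinearMap.comp_assoc _ H,
      hpH, hφe]
    abel
  have hXY : ∀ x, X x = B.m (Y x) - Y (A.m x) := by
    intro x
    change B.m (G x) - G (A.m x) = _
    simp only [hYx, map_sub, map_add, B.m_m, A.m_m, F.comm_apply, map_zero]
    abel
  have hYΔ : comul k W ∘ₗ Y = (TensorProduct.map F.F Y + TensorProduct.map Y G +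
      TensorProduct.map (H ∘ₗ koszul 𝒱) X) ∘ₗ comul k V := by
    rw [hY, LinearMap.comp_sub, hG.sub_isCoder F.isCohom,
      comul_homotopy F.degree_zero F.comm hHd hH, ← LinearMap.sub_comp]
    congr 1
    refine TensorProduct.ext' fun x y => ?_
    simp only [LinearMap.add_apply, LinearMap.sub_apply, TensorProduct.map_tmul,
      TensorProduct.tmul_sub, TensorProduct.sub_tmul, ← hX]
    abel
  have hYn : ∀ n, AgreeBelow n X 0 → AgreeBelow (n + 1) Y 0 := by
    intro n hn
    refine agreeBelow_of_comul hYΔ F.isCohom hG ?_ (by simp [koszul_one, hH1]) hpY hn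
    rw [← LinearMap.comp_assoc, hH.counit_comp hFκ hG, LinearMap.zero_comp]
  have hX0 : X = 0 := by
    refine eq_of_agreeBelow_succ fun n hn => ?_
    have hcod : IsCoder (G ∘ₗ koszul 𝒱) G X := isCoder_commutator hG hGd
    -- Now `Y` vanishes on words of length at most `n`, which kills `m' Y` there; `π Y m` is zero
    -- because `π Y = 0` on everything, whatever words `m` produces.
    refine hcod.agreeBelow (hG.comp isCohom_koszul) hG fun l hl => ?_
    have e := LinearMap.congr_fun hpY (A.m (word k l))
    simp only [LinearMap.comp_apply, LinearMap.zero_apply] at e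
    simp [hXY, hYn n hn l hl, e]
  have hY0 : Y = 0 := by
    refine eq_of_agreeBelow_succ fun n _ => hYn n ?_
    rw [hX0]
    exact fun _ _ => rfl
  exact ⟨AInfHom.ofCohom G hG hGd (sub_eq_zero.1 hX0).symm, H, hpH, hH, sub_eq_zero.1 hY0⟩

end AInf
end

/-! ### The direct sum of an A∞-algebra and a contractible complex -/

noncomputable section

namespace AInf

section Gradings

variable {k : Type*} [Field k]
  {V : Type*} [AddCommGroup V] [Module k V] (𝒱 : ℤ → Submodule k V)
  {W : Type*} [AddCommGroup W] [Module k W] (𝒲 : ℤ → Submodule k W)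

/-- The direct sum of two graded vector spaces. -/
def prodGrading (d : ℤ) : Submodule k (V × W) := (𝒱 d).prod (𝒲 d)

/-- The shift of a graded vector space. -/
def shiftGrading (d : ℤ) : Submodule k W := 𝒲 (d - 1)

variable {𝒱 𝒲}

lemma linDegree_inl : LinDegree 𝒱 (prodGrading 𝒱 𝒲) 0 (LinearMap.inl k V W) := by
  intro d v hv
  rw [add_zero]
  exact ⟨hv, (𝒲 d).zero_mem⟩

lemma linDegree_inr : LinDegree 𝒲 (prodGrading 𝒱 𝒲) 0 (LinearMap.inr k V W) := by
  intro d v hv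
  rw [add_zero]
  exact ⟨(𝒱 d).zero_mem, hv⟩

lemma linDegree_fst : LinDegree (prodGrading 𝒱 𝒲) 𝒱 0 (LinearMap.fst k V W) := by
  intro d v hv
  rw [add_zero]
  exact hv.1

lemma linDegree_snd : LinDegree (prodGrading 𝒱 𝒲) 𝒲 0 (LinearMap.snd k V W) := by
  intro d v hv
  rw [add_zero]
  exact hv.2

lemma linDegree_shift : LinDegree 𝒲 (shiftGrading 𝒲) 1 (LinearMap.id : W →ₗ[k] W) := by
  intro d w hw
  simpa [shiftGrading] using hw

lemma linDegree_unshift : LinDegree (shiftGrading 𝒲) 𝒲 (-1) (LinearMap.id : W →ₗ[k] W) :=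
  fun _ _ hw => hw

variable (𝒱 𝒲) [DirectSum.Decomposition 𝒱] [DirectSum.Decomposition 𝒲]

/-- A linear map of degree `r` sends the decomposition of its source to that of its target. -/
def liftDecompose {X : Type*} [AddCommGroup X] [Module k X] {𝒳 : ℤ → Submodule k X} {r : ℤ}
    {f : V →ₗ[k] X} (hf : LinDegree 𝒱 𝒳 r f) : V →ₗ[k] ⨁ d, 𝒳 d :=
  DirectSum.toModule k ℤ _ (fun d => DirectSum.lof k ℤ (fun e => 𝒳 e) (d + r) ∘ₗ
    f.restrict (hf d)) ∘ₗ (DirectSum.decomposeLinearEquiv 𝒱).toLinearMap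

variable {𝒱} in
lemma liftDecompose_of_mem {X : Type*} [AddCommGroup X] [Module k X] {𝒳 : ℤ → Submodule k X} {r : ℤ}
    {f : V →ₗ[k] X} (hf : LinDegree 𝒱 𝒳 r f) {d e : ℤ} (he : d + r = e) {v : V} (hv : v ∈ 𝒱 d) :
    liftDecompose 𝒱 hf v = DirectSum.lof k ℤ (fun e => 𝒳 e) e ⟨f v, he ▸ hf d v hv⟩ := by
  subst he
  simp only [liftDecompose, LinearMap.comp_apply, LinearEquiv.coe_coe,
    DirectSum.decomposeLinearEquiv_apply]
  rw [DirectSum.decompose_of_mem 𝒱 hv, ← DirectSum.lof_eq_of k, DirectSum.toModule_lof]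
  rfl

variable {𝒱} in
lemma coe_liftDecompose {X : Type*} [AddCommGroup X] [Module k X] {𝒳 : ℤ → Submodule k X} {r : ℤ}
    {f : V →ₗ[k] X} (hf : LinDegree 𝒱 𝒳 r f) (v : V) :
    DirectSum.coeLinearMap 𝒳 (liftDecompose 𝒱 hf v) = f v := by
  refine ext_homogeneous 𝒱 (f := DirectSum.coeLinearMap 𝒳 ∘ₗ liftDecompose 𝒱 hf) (g := f)
    (fun d v hv => ?_) v
  rw [LinearMap.comp_apply, liftDecompose_of_mem hf rfl hv, DirectSum.coeLinearMap_lof]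

instance : DirectSum.Decomposition (shiftGrading 𝒲) :=
  DirectSum.Decomposition.ofLinearMap _ (liftDecompose 𝒲 linDegree_shift)
    (by ext w : 1; exact coe_liftDecompose _ w)
    (by
      refine DirectSum.linearMap_ext k fun d => ?_
      ext1 w
      rw [LinearMap.comp_apply, LinearMap.comp_apply, DirectSum.coeLinearMap_lof,
        liftDecompose_of_mem linDegree_shift (sub_add_cancel d 1) w.2]
      rfl)

instance : DirectSum.Decomposition (prodGrading 𝒱 𝒲) :=
  DirectSum.Decomposition.ofLinearMap _
    (LinearMap.coprod (liftDecompose 𝒱 (linDegree_inl (𝒲 := 𝒲)))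
      (liftDecompose 𝒲 (linDegree_inr (𝒱 := 𝒱))))
    (by
      refine LinearMap.ext fun ⟨v, w⟩ => ?_
      rw [LinearMap.comp_apply, LinearMap.coprod_apply, map_add, coe_liftDecompose,
        coe_liftDecompose]
      simp)
    (by
      refine DirectSum.linearMap_ext k fun d => ?_
      ext1 w
      rw [LinearMap.comp_apply, LinearMap.comp_apply, DirectSum.coeLinearMap_lof,
        LinearMap.coprod_apply, liftDecompose_of_mem linDegree_inl (add_zero d) w.2.1,
        liftDecompose_of_mem linDegree_inr (add_zero d) w.2.2, ← map_add]
      congr 1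
      ext <;> simp)

end Gradings

section AddComplex

variable {k : Type*} [Field k]
  {V : Type*} [AddCommGroup V] [Module k V] {𝒱 : ℤ → Submodule k V} [DirectSum.Decomposition 𝒱]
  {Q : Type*} [AddCommGroup Q] [Module k Q] {𝒬 : ℤ → Submodule k Q} [DirectSum.Decomposition 𝒬]

/-- The mixed terms `κ m ⊗ m` and `m κ ⊗ m` cancel because `m` is odd. So `m² = 0` may be tested on
components. -/
lemma isCoder_sq {m : TensorAlgebra k V →ₗ[k] TensorAlgebra k V} (hm : HasDegree 𝒱 𝒱 1 m)
    (hc : IsCoder (koszul 𝒱) LinearMap.id m) : IsCoder LinearMap.id LinearMap.id (m ∘ₗ m) := by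
  unfold IsCoder at *
  rw [← LinearMap.comp_assoc, hc, LinearMap.comp_assoc, hc, ← LinearMap.comp_assoc]
  congr 1
  have s1 := fun x => LinearMap.congr_fun hm.koszul_comp_one x
  have s2 := fun x => LinearMap.congr_fun (koszul_koszul (𝒱 := 𝒱)) x
  simp only [LinearMap.comp_apply, LinearMap.neg_apply, LinearMap.id_apply] at s1 s2
  refine TensorProduct.ext' fun x y => ?_
  simp only [LinearMap.add_apply, LinearMap.comp_apply, TensorProduct.map_tmul, map_add, s1, s2,
    LinearMap.id_apply, TensorProduct.neg_tmul]
  abel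

/-- The codifferential of the direct sum of an `A∞`-algebra and a complex. -/
def sumCodiff (A : AInfAlgebra 𝒱) (𝒬 : ℤ → Submodule k Q) [DirectSum.Decomposition 𝒬]
    (dQ : Q →ₗ[k] Q) : TensorAlgebra k (V × Q) →ₗ[k] TensorAlgebra k (V × Q) :=
  coderOf (koszul (prodGrading 𝒱 𝒬)) LinearMap.id
    -- The operations of `A` see only the `V`-parts of the letters, and `Q` contributes nothing
    -- beyond its differential.
    (LinearMap.inl k V Q ∘ₗ proj k V ∘ₗ A.m ∘ₗ strictMap (LinearMap.fst k V Q) +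
      LinearMap.inr k V Q ∘ₗ dQ ∘ₗ LinearMap.snd k V Q ∘ₗ proj k (V × Q))

variable (A : AInfAlgebra 𝒱) {dQ : Q →ₗ[k] Q}

lemma proj_sumCodiff (dQ : Q →ₗ[k] Q) (x : TensorAlgebra k (V × Q)) :
    proj k (V × Q) (sumCodiff A 𝒬 dQ x) =
      (proj k V (A.m (strictMap (LinearMap.fst k V Q) x)), dQ (proj k (V × Q) x).2) := by
  refine (LinearMap.congr_fun (proj_comp_coderOf isCohom_koszul IsCohom.id _) x).trans ?_
  simp

lemma isCoder_sumCodiff (dQ : Q →ₗ[k] Q) :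
    IsCoder (koszul (prodGrading 𝒱 𝒬)) LinearMap.id (sumCodiff A 𝒬 dQ) :=
  isCoder_coderOf isCohom_koszul IsCohom.id _

lemma hasDegree_sumCodiff (hdQ : LinDegree 𝒬 𝒬 1 dQ) :
    HasDegree (prodGrading 𝒱 𝒬) (prodGrading 𝒱 𝒬) 1 (sumCodiff A 𝒬 dQ) := by
  refine hasDegree_coderOf hasDegree_koszul hasDegree_id (CompDegree.add ?_ ?_)
  · exact linDegree_inl.comp_compDegree (A.degree_one.compDegree.comp
      (hasDegree_strictMap linDegree_fst) (zero_add 1)) (add_zero 1)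
  · exact linDegree_inr.comp_compDegree (hdQ.comp_compDegree
      (linDegree_snd.comp_compDegree compDegree_proj (add_zero 0)) (zero_add 1)) (add_zero 1)

lemma strictMap_fst_sumCodiff (dQ : Q →ₗ[k] Q) :
    strictMap (LinearMap.fst k V Q) ∘ₗ sumCodiff A 𝒬 dQ =
      A.m ∘ₗ strictMap (LinearMap.fst k V Q) := by
  have hp := isCohom_strictMap (LinearMap.fst k V Q)
  have hd : HasDegree (prodGrading 𝒱 𝒬) 𝒱 0 (strictMap (LinearMap.fst k V Q)) :=
    hasDegree_strictMap linDegree_fst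
  have h1 := (isCoder_sumCodiff A (𝒬 := 𝒬) dQ).comp_left hp
  have h2 := A.isCoder.comp_right hp
  rw [hd.koszul_comp_even] at h2
  refine h1.ext h2 (hp.comp isCohom_koszul) hp ?_
  rw [← LinearMap.comp_assoc, proj_comp_strictMap]
  ext x : 1
  simp [proj_sumCodiff]

/-- The direct sum of an `A∞`-algebra and a complex. -/
def AInfAlgebra.addComplex (hdQ : LinDegree 𝒬 𝒬 1 dQ) (hdd : ∀ q, dQ (dQ q) = 0) :
    AInfAlgebra (prodGrading 𝒱 𝒬) where
  m := sumCodiff A 𝒬 dQ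
  degree_one := hasDegree_sumCodiff A hdQ
  coderivation := by
    have := isCoder_sumCodiff A (𝒬 := 𝒬) dQ
    unfold IsCoder at this
    rw [this, add_comm]
    rfl
  sq_zero := by
    refine (isCoder_sq (hasDegree_sumCodiff A hdQ) (isCoder_sumCodiff A dQ)).eq_zero
      IsCohom.id IsCohom.id ?_
    ext x : 1
    have := LinearMap.congr_fun (strictMap_fst_sumCodiff A (𝒬 := 𝒬) dQ) x
    simp only [LinearMap.comp_apply] at this ⊢
    rw [proj_sumCodiff, proj_sumCodiff, this, A.m_m, hdd, map_zero]
    rfl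
  m_zero := by
    rw [proj_sumCodiff, (isCohom_strictMap _).map_one, A.m_one, proj_one]
    simp

variable (hdQ : LinDegree 𝒬 𝒬 1 dQ) (hdd : ∀ q, dQ (dQ q) = 0)

lemma proj_addComplex (x : TensorAlgebra k (V × Q)) :
    proj k (V × Q) ((A.addComplex hdQ hdd).m x) =
      (proj k V (A.m (strictMap (LinearMap.fst k V Q) x)), dQ (proj k (V × Q) x).2) :=
  proj_sumCodiff A dQ x

lemma strictMap_fst_inl (x : TensorAlgebra k V) :
    strictMap (LinearMap.fst k V Q) (strictMap (LinearMap.inl k V Q) x) = x := by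
  have h : strictMap (LinearMap.fst k V Q) ∘ₗ strictMap (LinearMap.inl k V Q) = LinearMap.id := by
    refine ((isCohom_strictMap _).comp (isCohom_strictMap _)).ext IsCohom.id ?_
    rw [← LinearMap.comp_assoc, proj_comp_strictMap, LinearMap.comp_assoc, proj_comp_strictMap,
      ← LinearMap.comp_assoc, LinearMap.fst_comp_inl]
    rfl
  exact LinearMap.congr_fun h x

/-- The projection of the direct sum of an `A∞`-algebra and a complex onto the `A∞`-algebra. -/
def AInfHom.fst : AInfHom (A.addComplex hdQ hdd) A :=
  AInfHom.ofCohom (strictMap (LinearMap.fst k V Q)) (isCohom_strictMap _)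
    (hasDegree_strictMap linDegree_fst) (strictMap_fst_sumCodiff A dQ)

lemma proj_strictMap_apply {X : Type*} [AddCommGroup X] [Module k X] (f : V →ₗ[k] X)
    (x : TensorAlgebra k V) : proj k X (strictMap f x) = f (proj k V x) :=
  LinearMap.congr_fun (proj_comp_strictMap f) x

/-- The inclusion of an `A∞`-algebra into its direct sum with a complex. -/
def AInfHom.inl : AInfHom A (A.addComplex hdQ hdd) :=
  AInfHom.ofCohom (strictMap (LinearMap.inl k V Q)) (isCohom_strictMap _)
    (hasDegree_strictMap linDegree_inl) (by
      have hp := isCohom_strictMap (LinearMap.inl k V Q)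
      have hd : HasDegree 𝒱 (prodGrading 𝒱 𝒬) 0 (strictMap (LinearMap.inl k V Q)) :=
        hasDegree_strictMap linDegree_inl
      have h1 := A.isCoder.comp_left hp
      have h2 := (A.addComplex hdQ hdd).isCoder.comp_right hp
      rw [hd.koszul_comp_even] at h2
      refine h1.ext h2 (hp.comp isCohom_koszul) hp ?_
      ext1 x
      simp only [LinearMap.comp_apply]
      rw [proj_strictMap_apply, proj_addComplex, strictMap_fst_inl, proj_strictMap_apply]
      simp)

lemma AInfHom.fst_comp_inl :
    (AInfHom.fst A hdQ hdd).comp (AInfHom.inl A hdQ hdd) = AInfHom.id A :=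
  AInfHom.ext_F (LinearMap.ext strictMap_fst_inl)

/-- The component is `-s` on single letters, with the sign dictated by `i p - 1 = -1` on `Q`. Since
it takes values in `Q`, the operator `H` is killed by `p`; the operations of `A` then drop out and
the equation reduces to `d s + s d = 1`. -/
lemma AInfHom.inl_comp_fst_strictlyHomotopic {s : Q →ₗ[k] Q} (hs : LinDegree 𝒬 𝒬 (-1) s)
    (hds : ∀ q, dQ (s q) + s (dQ q) = q) :
    AInfHom.StrictlyHomotopic ((AInfHom.inl A hdQ hdd).comp (AInfHom.fst A hdQ hdd))
      (AInfHom.id (A.addComplex hdQ hdd)) := by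
  set h : TensorAlgebra k (V × Q) →ₗ[k] V × Q :=
    -(LinearMap.inr k V Q ∘ₗ s ∘ₗ LinearMap.snd k V Q ∘ₗ proj k (V × Q)) with hh
  have hx : ∀ x, h x = (0, -s (proj k (V × Q) x).2) := fun x => by simp [hh]
  refine AInfHom.strictlyHomotopic_of_component (h := h) ?_ ?_ fun x => ?_
  · exact (linDegree_inr.comp_compDegree (hs.comp_compDegree
      (linDegree_snd.comp_compDegree compDegree_proj (add_zero 0)) (zero_add _)) (add_zero _)).neg
  · simp [hx, proj_one]
  · have hid : IsCohom ((AInfHom.id (A.addComplex hdQ hdd)).F ∘ₗ koszul (prodGrading 𝒱 𝒬)) :=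
      (AInfHom.id _).isCohom.comp isCohom_koszul
    set K := (AInfHom.inl A hdQ hdd).comp (AInfHom.fst A hdQ hdd) with hK
    set H := coderOf ((AInfHom.id (A.addComplex hdQ hdd)).F ∘ₗ koszul (prodGrading 𝒱 𝒬)) K.F h
    have hp := isCohom_strictMap (LinearMap.fst k V Q)
    have hpH : ∀ x, proj k (V × Q) (H x) = h x :=
      fun x => LinearMap.congr_fun (proj_comp_coderOf hid K.isCohom h) x
    have hz : strictMap (LinearMap.fst k V Q) ∘ₗ H = 0 := by
      refine ((isCoder_coderOf hid K.isCohom h).comp_left hp).eq_zero (hp.comp hid)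
        (hp.comp K.isCohom) ?_
      ext1 y
      rw [LinearMap.comp_apply, LinearMap.comp_apply, proj_strictMap_apply, hpH, hx]
      rfl
    have hz' := LinearMap.congr_fun hz x
    rw [LinearMap.comp_apply, LinearMap.zero_apply] at hz'
    have hKx : proj k (V × Q) (K.F x) = ((proj k (V × Q) x).1, 0) := by
      change proj k (V × Q) (strictMap (LinearMap.inl k V Q) (strictMap (LinearMap.fst k V Q) x)) = _
      rw [proj_strictMap_apply, proj_strictMap_apply]
      rfl
    have hI : (AInfHom.id (A.addComplex hdQ hdd)).F x = x := rfl
    have e := hds (proj k (V × Q) x).2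
    rw [hKx, hI, hx (_ : TensorAlgebra k (V × Q)), proj_addComplex, proj_addComplex, hz', hpH, hx]
    ext
    · simp
    · simp only [map_zero, Prod.snd_sub, Prod.snd_add, map_neg]
      rw [← neg_add, e, zero_sub]

end AddComplex

end AInf
end

/-! ### Reduction of a quasi-isomorphism to one with surjective linear part -/

noncomputable section

namespace AInf

variable {k : Type*} [Field k]
  {V : Type*} [AddCommGroup V] [Module k V] {𝒱 : ℤ → Submodule k V} [DirectSum.Decomposition 𝒱]
  {W : Type*} [AddCommGroup W] [Module k W] {𝒲 : ℤ → Submodule k W} [DirectSum.Decomposition 𝒲]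
  {A : AInfAlgebra 𝒱} {B : AInfAlgebra 𝒲}

namespace AInfHom

/-- An `A∞`-morphism whose linear part is surjective with acyclic kernel is a strict homotopy
equivalence with a right inverse. -/
theorem exists_right_inverse (F : AInfHom A B) (hs : Function.Surjective F.f1)
    (hk : ∀ v, F.f1 v = 0 → A.m1 v = 0 → ∃ u, F.f1 u = 0 ∧ A.m1 u = v) :
    ∃ G : AInfHom B A, F.comp G = AInfHom.id B ∧
      StrictlyHomotopic (G.comp F) (AInfHom.id A) := by
  obtain ⟨r⟩ := Retraction.nonempty F hs hk
  exact ⟨r.inv, r.comp_inv, r.strictlyHomotopic⟩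

/-- Every `A∞`-morphism `F : A → B` extends along the inclusion of `A` into `A ⊕ Q`, for a
contractible complex `Q` that surjects onto `B`. -/
theorem exists_extension (F : AInfHom A B) {Q : Type*} [AddCommGroup Q] [Module k Q]
    {𝒬 : ℤ → Submodule k Q} [DirectSum.Decomposition 𝒬] {dQ : Q →ₗ[k] Q}
    (hdQ : LinDegree 𝒬 𝒬 1 dQ) (hdd : ∀ q, dQ (dQ q) = 0) {θ : Q →ₗ[k] W}
    (hθ : LinDegree 𝒬 𝒲 (-1) θ) :
    ∃ F' : AInfHom (A.addComplex hdQ hdd) B, F'.comp (inl A hdQ hdd) = F ∧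
      ∀ v q, F'.f1 (v, q) = F.f1 v + (B.m1 (θ q) + θ (dQ q)) := by
  set h : TensorAlgebra k (V × Q) →ₗ[k] W := θ ∘ₗ LinearMap.snd k V Q ∘ₗ proj k (V × Q) with hh
  have hd : CompDegree (prodGrading 𝒱 𝒬) 𝒲 (-1) h :=
    hθ.comp_compDegree (linDegree_snd.comp_compDegree compDegree_proj (add_zero 0)) (zero_add _)
  have h1 : h 1 = 0 := by simp [hh, proj_one]
  -- `F'` is the end point of the homotopy that starts at `F p` and has component `θ` on the
  -- `Q`-letters. That component vanishes on the image of `i`, so `H i = 0` and `F' i = F p i = F`.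
  obtain ⟨F', H, hpH, hH, heq⟩ := exists_transport (F.comp (fst A hdQ hdd)) hd h1
  have hκ := (F.comp (fst A hdQ hdd)).isCohom.comp (isCohom_koszul (𝒱 := prodGrading 𝒱 𝒬))
  have hx := fun x => LinearMap.congr_fun heq x
  have hpHx := fun x => LinearMap.congr_fun hpH x
  simp only [LinearMap.sub_apply, LinearMap.add_apply, LinearMap.comp_apply] at hx hpHx
  have hFf : ∀ x, (F.comp (fst A hdQ hdd)).F ((inl A hdQ hdd).F x) = F.F x :=
    fun x => congrArg F.F (strictMap_fst_inl x)
  refine ⟨F', ext_F (LinearMap.ext fun x => ?_), fun v q => ?_⟩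
  · have hHi : H ∘ₗ (inl A hdQ hdd).F = 0 := by
      refine (hH.comp_right (inl A hdQ hdd).isCohom).eq_zero (hκ.comp (inl A hdQ hdd).isCohom)
        (F'.isCohom.comp (inl A hdQ hdd).isCohom) ?_
      ext1 y
      rw [LinearMap.comp_apply, LinearMap.comp_apply, hpHx]
      change θ (proj k (V × Q) (strictMap (LinearMap.inl k V Q) y)).2 = 0
      rw [proj_strictMap_apply]
      simp
    have hHi' := fun x => LinearMap.congr_fun hHi x
    simp only [LinearMap.comp_apply, LinearMap.zero_apply] at hHi'
    have := hx ((inl A hdQ hdd).F x)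
    rw [← comm_apply, hHi', hHi', map_zero, add_zero, sub_eq_zero, hFf] at this
    exact this
  · have hι : ∀ u : V × Q, H (TensorAlgebra.ι k u) = TensorAlgebra.ι k (θ u.2) := by
      intro u
      -- With `n = 1` the only word to check is the empty one, where `h` vanishes; it follows that
      -- `H` sends letters to letters.
      have e := (hH.agreeBelow_succ hκ F'.isCohom (n := 1) (by
        intro l hl
        obtain rfl : l = [] := List.length_eq_zero_iff.1 (by omega)
        rw [LinearMap.comp_apply, hpHx, word_nil, h1]
        rfl)) [u] (by simp)
      simp only [word_cons, word_nil, mul_one, LinearMap.comp_apply, hpHx] at e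
      simpa [hh, proj_ι] using e
    have e := congrArg (proj k W) (hx (TensorAlgebra.ι k (v, q)))
    have hm : ((A.addComplex hdQ hdd).m1 (v, q)).2 = dQ q := by
      change (proj k (V × Q) ((A.addComplex hdQ hdd).m _)).2 = _
      rw [proj_addComplex, proj_ι]
    have hf : (F.comp (fst A hdQ hdd)).f1 (v, q) = F.f1 v := by
      rw [comp_f1]
      congr 1
      change proj k V (strictMap (LinearMap.fst k V Q) _) = v
      rw [proj_strictMap_apply, proj_ι]
      rfl
    rw [F_ι, F_ι, AInfAlgebra.m_ι, hι, hι, AInfAlgebra.m_ι, hm, hf] at e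
    simp only [map_sub, map_add, proj_ι] at e
    rw [← e]; abel

/-- An `A∞`-quasi-isomorphism is a strict homotopy equivalence. -/
theorem IsQuasiIso.isStrictHomotopyEquiv {F : AInfHom A B} (hF : F.IsQuasiIso) :
    F.IsStrictHomotopyEquiv := by
  rw [isQuasiIso_iff] at hF
  obtain ⟨hinj, hsurj⟩ := hF
  -- `Q` is `W` plus its shift with differential `(x, y) ↦ (0, x)`, contracted by `s`. With `θ (x,
  -- y) = y` the linear part of `F'` is `f₁ v + m₁' y + x`, and the summand `x` makes it surjective.
  set dQ : W × W →ₗ[k] W × W := LinearMap.inr k W W ∘ₗ LinearMap.fst k W W with hdQdef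
  set s : W × W →ₗ[k] W × W := LinearMap.inl k W W ∘ₗ LinearMap.snd k W W with hsdef
  have hdQ : LinDegree (prodGrading 𝒲 (shiftGrading 𝒲)) (prodGrading 𝒲 (shiftGrading 𝒲)) 1 dQ :=
    linDegree_inr.comp (linDegree_shift.comp linDegree_fst (zero_add 1)) (add_zero 1)
  have hθ : LinDegree (prodGrading 𝒲 (shiftGrading 𝒲)) 𝒲 (-1) (LinearMap.snd k W W) :=
    linDegree_unshift.comp linDegree_snd (zero_add _)
  have hs : LinDegree (prodGrading 𝒲 (shiftGrading 𝒲)) (prodGrading 𝒲 (shiftGrading 𝒲)) (-1) s :=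
    linDegree_inl.comp hθ (add_zero _)
  have hdd : ∀ q, dQ (dQ q) = 0 := fun q => by simp [hdQdef]
  have hds : ∀ q, dQ (s q) + s (dQ q) = q := fun q => by simp [hdQdef, hsdef]
  obtain ⟨F', hF', hf1⟩ := exists_extension F hdQ hdd hθ
  have hf1' : ∀ v x y, F'.f1 (v, (x, y)) = F.f1 v + (B.m1 y + x) := fun v x y => hf1 v (x, y)
  have hm1 : ∀ v x y, (A.addComplex hdQ hdd).m1 (v, (x, y)) = (A.m1 v, (0, x)) := by
    intro v x y
    change proj k _ ((A.addComplex hdQ hdd).m _) = _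
    rw [proj_addComplex, proj_ι]
    have e : strictMap (LinearMap.fst k V (W × W)) (TensorAlgebra.ι k (v, (x, y))) =
        TensorAlgebra.ι k v := by
      have h1 := (fst A hdQ hdd).F_ι (v, (x, y))
      have h2 : (fst A hdQ hdd).f1 (v, (x, y)) = v := by
        change proj k V (strictMap (LinearMap.fst k V (W × W)) _) = v
        rw [proj_strictMap_apply, proj_ι]
        rfl
      rw [h2] at h1
      exact h1
    rw [e]
    rfl
  obtain ⟨G, hG1, hG2⟩ := exists_right_inverse F'
    (fun w => ⟨(0, (w, 0)), by rw [hf1']; simp⟩)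
    (by
      rintro ⟨v, x, y⟩ hf hm
      rw [hm1] at hm
      rw [hf1'] at hf
      simp only [Prod.mk_eq_zero] at hm
      obtain ⟨hv, -, rfl⟩ := hm
      rw [add_zero] at hf
      -- A cycle `(v, 0, y)` in the kernel satisfies `f₁ v = m₁' (-y)`, so injectivity on cohomology
      -- gives `v = m₁ u`.
      obtain ⟨u, rfl⟩ := hinj v hv (-y) (by rw [map_neg]; exact eq_neg_of_add_eq_zero_left hf)
      -- Now `f₁ u + y` is a cycle, and surjectivity on cohomology writes it as `f₁ c + m₁' w`.
      -- Correcting `u` by `c` and using `-w` as the last coordinate puts the primitive in the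
      -- kernel.
      obtain ⟨c, w, hc, hw⟩ := hsurj (F.f1 u + y) (by rw [map_add, ← F.f1_m1, hf])
      refine ⟨(u - c, (y, -w)), ?_, ?_⟩
      · rw [hf1', map_sub, map_neg]
        have : F.f1 u - F.f1 c + (-B.m1 w + y) = F.f1 u + y - (F.f1 c + B.m1 w) := by abel
        rw [this, hw, sub_self]
      · rw [hm1, map_sub, hc, sub_zero])
  refine ⟨(fst A hdQ hdd).comp G, ?_, ?_⟩
  · have h := (hG2.comp_left (fst A hdQ hdd)).comp_right (inl A hdQ hdd)
    have e : ((fst A hdQ hdd).comp G).comp F = ((fst A hdQ hdd).comp (G.comp F')).comp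
        (inl A hdQ hdd) := by
      conv_lhs => rw [← hF']
      rfl
    rw [e, ← fst_comp_inl A hdQ hdd]
    exact h
  · have h := ((inl_comp_fst_strictlyHomotopic A hdQ hdd hs hds).comp_left F').comp_right G
    have e : F.comp ((fst A hdQ hdd).comp G) =
        (F'.comp ((inl A hdQ hdd).comp (fst A hdQ hdd))).comp G := by
      conv_lhs => rw [← hF']
      rfl
    rw [e, ← hG1]
    exact h

theorem isQuasiIso_iff_isStrictHomotopyEquiv (F : AInfHom A B) :
    F.IsQuasiIso ↔ F.IsStrictHomotopyEquiv :=
  ⟨fun h => h.isStrictHomotopyEquiv, fun h => h.isQuasiIso⟩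

end AInfHom

end AInf
end

theorem theorem6p4 {k : Type*} [Field k] [CharZero k]
    {V : Type*} [AddCommGroup V] [Module k V]
    {𝒱 : ℤ → Submodule k V} [DirectSum.Decomposition 𝒱]
    {W : Type*} [AddCommGroup W] [Module k W]
    {𝒲 : ℤ → Submodule k W} [DirectSum.Decomposition 𝒲]
    (A : AInf.AInfAlgebra 𝒱) (B : AInf.AInfAlgebra 𝒲) :
    (∀ F : AInf.AInfHom A B, F.IsQuasiIso →
      ∃ G : AInf.AInfHom B A, G.IsQuasiIso ∧
        AInf.AInfHom.Homotopic (G.comp F) (AInf.AInfHom.id A) ∧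
        AInf.AInfHom.Homotopic (F.comp G) (AInf.AInfHom.id B)) ∧
    (∀ F : AInf.AInfHom A B, F.IsQuasiIso ↔ F.IsStrictHomotopyEquiv) ∧
    ((∃ F : AInf.AInfHom A B, F.IsQuasiIso) ↔
      ∃ F : AInf.AInfHom A B, F.IsStrictHomotopyEquiv) := by
  refine ⟨fun F hF => ?_, AInf.AInfHom.isQuasiIso_iff_isStrictHomotopyEquiv, ?_⟩
  · obtain ⟨G, hGF, hFG⟩ := hF.isStrictHomotopyEquiv
    -- The definition is symmetric in `F` and `G`, so the inverse is itself a quasi-isomorphism.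
    have hG : G.IsStrictHomotopyEquiv := ⟨F, hFG, hGF⟩
    exact ⟨G, hG.isQuasiIso, hGF.homotopic, hFG.homotopic⟩
  · simp only [AInf.AInfHom.isQuasiIso_iff_isStrictHomotopyEquiv]
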